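/- **Theorem.** A deterministic transition system $\mathcal T=(\Sigma,Q,\delta,q_0)$ consists of a finite alphabet $\Sigma$, a finite set $Q$ of states, a transition function $\delta:Q\times\Sigma\to Q$ and an initial state $q_0\in Q$. For $\alpha\in\Sigma^\omega$ let $\mathrm{Inf}_{\mathcal T}(\alpha)$ be the set of states that occur infinitely often in the run of $\mathcal T$ on $\alpha$. A parity condition on $\mathcal T$ is a function $c:Q\to\mathbb N$; its number of priorities is $|c(Q)|$. The pair $(\mathcal T,c)$ is called a deterministic parity automaton (DPA), and its language is $L(\mathcal T,c)=\{\alpha\in\Sigma^\omega \mid \max c(\mathrm{Inf}_{\mathcal T}(\alpha)) \text{ is even}\}$. A homomorphism from $\mathcal T$ to a transition system $\mathcal T'=(\Sigma,Q',\delta',q_0')$ is a function $h:Q\to Q'$ with $h(q_0)=q_0'$ and $h(\delta(q,a))=\delta'(h(q),a)$ for all $q\in Q$, $a\in\Sigma$. There is a polynomial-time algorithm that, given a DPA $\mathcal A=(\mathcal T,c)$, a DPA $\mathcal D$ over the same alphabet $\Sigma$ with language $D:=L(\mathcal D)$, a deterministic transition system $\mathcal T'$ over $\Sigma$, and a surjective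 homomorphism $h:\mathcal T\to\mathcal T'$ (with transition functions, priorities and $h$ given as explicit tables, and numbers in binary), decides whether there is a parity condition $c'$ on $\mathcal T'$ with $$L(\mathcal T',c')\setminus D = L(\mathcal A)\setminus D ,$$ and, if there is one, outputs such a $c'$ with the smallest possible number of priorities among all parity conditions with this property. -/

import Mathlib

/-! ### Deterministic transition systems and parity automata on infinite words -/

namespace DontCare

/-- A deterministic transition system with alphabet `A` and state set `Q`. -/
structure TransSystem (A Q : Type*) where
  init : Q
  step : Q → A → Q

/-- The run on an infinite word. -/
def TransSystem.run {A Q : Type*} (T : TransSystem A Q) (α : ℕ → A) : ℕ → Q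
  | 0 => T.init
  | i + 1 => T.step (T.run α i) (α i)

/-- The set of states that occur infinitely often in the run on `α`. -/
def TransSystem.infs {A Q : Type*} (T : TransSystem A Q) (α : ℕ → A) : Set Q :=
  {q | {i : ℕ | T.run α i = q}.Infinite}

/-- A deterministic parity automaton `(T, c)` with `c` the priority function. -/
structure DPA (A Q : Type*) where
  toTS : TransSystem A Q
  prio : Q → ℕ

/-- The language of a DPA: the greatest priority visited infinitely often is even. -/
def DPA.lang {A Q : Type*} (M : DPA A Q) : Set (ℕ → A) :=
  {α | ∃ m, IsGreatest (M.prio '' M.toTS.infs α) m ∧ Even m}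

/-- `L` and `L'` agree outside of the don't care set `D`. -/
def EquivOutside {A : Type*} (D L L' : Set (ℕ → A)) : Prop :=
  L \ D = L' \ D

/-- Homomorphisms of transition systems over the same alphabet. -/
structure IsHom {A Q Q' : Type*} (T : TransSystem A Q) (T' : TransSystem A Q') (h : Q → Q') :
    Prop where
  map_init : h T.init = T'.init
  map_step : ∀ q a, h (T.step q a) = T'.step (h q) a

/-- The number of priorities that a parity condition uses. -/
def numPriorities {Q : Type*} [Fintype Q] (c : Q → ℕ) : ℕ :=
  (Finset.univ.image c).card

/-! ### The optimization problem -/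

/-- An instance of Quotient Don't Care Priority Optimization. The alphabet and the state sets
are presented as initial segments of the natural numbers. -/
structure Instance where
  /-- number of letters -/
  k : ℕ
  /-- number of states of the automaton `M` -/
  n : ℕ
  /-- number of states of the don't care automaton `DC` -/
  d : ℕ
  /-- number of states of the quotient `T'` -/
  n' : ℕ
  M : DPA (Fin k) (Fin n)
  DC : DPA (Fin k) (Fin d)
  T' : TransSystem (Fin k) (Fin n')
  h : Fin n → Fin n'
  hom : IsHom M.toTS T' h
  surj : Function.Surjective h

namespace Instance

/-- `(T', c')` accepts the language of `M` up to the don't care words. -/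
def IsSolution (I : Instance) (c' : Fin I.n' → ℕ) : Prop :=
  EquivOutside I.DC.lang (DPA.lang ⟨I.T', c'⟩) I.M.lang

/-- A solution with the smallest possible number of priorities. -/
def IsOptimal (I : Instance) (c' : Fin I.n' → ℕ) : Prop :=
  I.IsSolution c' ∧ ∀ c'' : Fin I.n' → ℕ, I.IsSolution c'' → numPriorities c' ≤ numPriorities c''

/-- The correct answers: `none` if there is no solution, otherwise an optimal solution. -/
def IsCorrectAnswer (I : Instance) : Option (Fin I.n' → ℕ) → Prop
  | none => ¬ ∃ c' : Fin I.n' → ℕ, I.IsSolution c'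
  | some c' => I.IsOptimal c'

end Instance

/-! ### Encoding of instances and answers as lists of natural numbers -/

/-- The list of the values of `f`, in order. -/
def encodeFun {n : ℕ} (f : Fin n → ℕ) : List ℕ :=
  List.ofFn f

/-- The initial state, followed by the transition table, row by row. -/
def TransSystem.encode {k n : ℕ} (T : TransSystem (Fin k) (Fin n)) : List ℕ :=
  (T.init : ℕ) :: (List.finRange n).flatMap fun q => encodeFun fun a => (T.step q a : ℕ)

def DPA.encode {k n : ℕ} (M : DPA (Fin k) (Fin n)) : List ℕ :=
  M.toTS.encode ++ encodeFun M.prio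

def Instance.encode (I : Instance) : List ℕ :=
  [I.k, I.n, I.d, I.n'] ++ I.M.encode ++ I.DC.encode ++ I.T'.encode ++
    encodeFun fun q => (I.h q : ℕ)

def encodeAnswer {n : ℕ} : Option (Fin n → ℕ) → List ℕ
  | none => [0]
  | some c => 1 :: encodeFun c

/-- The size of a list of numbers: the total number of binary digits, plus one per entry. -/
def bitSize (l : List ℕ) : ℕ :=
  (l.map fun x => x.size + 1).sum

end DontCare

/-! ### Random access machines

Programs with finitely many registers and finitely many arrays of natural numbers, with indirect
addressing of array cells; the arithmetic operations are addition, truncated subtraction and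
halving. Every operation costs one unit. As there is no multiplication, the binary length of the
numbers grows at most linearly with the running time, and hence polynomial time on these
machines, measured against the binary length of the input, is the usual polynomial time. -/

namespace RAM

/-- `reg x` is the content of register `x`, and `arr a i` the content of cell `i` of array `a`. -/
structure State where
  reg : ℕ → ℕ
  arr : ℕ → ℕ → ℕ

def State.setReg (s : State) (x v : ℕ) : State :=
  { s with reg := Function.update s.reg x v }

def State.setArr (s : State) (a i v : ℕ) : State :=
  { s with arr := Function.update s.arr a (Function.update (s.arr a) i v) }

inductive Expr where
  | const (v : ℕ)
  | reg (x : ℕ)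
  | get (a : ℕ) (i : Expr)
  | plus (e f : Expr)
  | minus (e f : Expr)
  | half (e : Expr)

def Expr.eval (s : State) : Expr → ℕ
  | const v => v
  | reg x => s.reg x
  | get a i => s.arr a (i.eval s)
  | plus e f => e.eval s + f.eval s
  | minus e f => e.eval s - f.eval s
  | half e => e.eval s / 2

/-- The number of operations in the evaluation of an expression. -/
def Expr.cost : Expr → ℕ
  | const _ => 1
  | reg _ => 1
  | get _ i => i.cost + 1
  | plus e f => e.cost + f.cost + 1
  | minus e f => e.cost + f.cost + 1
  | half e => e.cost + 1

/-- Programs. The tests of `ite` and `loop` ask whether the value of the expression is nonzero. -/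
inductive Prog where
  | skip
  | assign (x : ℕ) (e : Expr)
  | store (a : ℕ) (i e : Expr)
  | seq (P R : Prog)
  | ite (e : Expr) (P R : Prog)
  | loop (e : Expr) (P : Prog)

/-- `Exec P s s' t`: started in the state `s`, the program `P` halts in the state `s'` after
`t` steps. -/
inductive Exec : Prog → State → State → ℕ → Prop where
  | skip (s : State) : Exec Prog.skip s s 1
  | assign (s : State) (x : ℕ) (e : Expr) :
      Exec (Prog.assign x e) s (s.setReg x (e.eval s)) (e.cost + 1)
  | store (s : State) (a : ℕ) (i e : Expr) :
      Exec (Prog.store a i e) s (s.setArr a (i.eval s) (e.eval s)) (i.cost + e.cost + 1)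
  | seq {P R : Prog} {s s' s'' : State} {t t' : ℕ} :
      Exec P s s' t → Exec R s' s'' t' → Exec (Prog.seq P R) s s'' (t + t')
  | iteTrue {e : Expr} {P R : Prog} {s s' : State} {t : ℕ} :
      e.eval s ≠ 0 → Exec P s s' t → Exec (Prog.ite e P R) s s' (e.cost + 1 + t)
  | iteFalse {e : Expr} {P R : Prog} {s s' : State} {t : ℕ} :
      e.eval s = 0 → Exec R s s' t → Exec (Prog.ite e P R) s s' (e.cost + 1 + t)
  | loopTrue {e : Expr} {P : Prog} {s s' s'' : State} {t t' : ℕ} :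
      e.eval s ≠ 0 → Exec P s s' t → Exec (Prog.loop e P) s' s'' t' →
        Exec (Prog.loop e P) s s'' (e.cost + 1 + t + t')
  | loopFalse {e : Expr} {P : Prog} {s : State} :
      e.eval s = 0 → Exec (Prog.loop e P) s s (e.cost + 1)

/-- The input stands in array `0` and its length in register `0`; all else is zero. -/
def State.initial (l : List ℕ) : State where
  reg x := if x = 0 then l.length else 0
  arr a i := if a = 0 then l.getD i 0 else 0

/-- The output stands in array `1` and its length in register `0`. -/
def State.output (s : State) : List ℕ :=
  (List.range (s.reg 0)).map (s.arr 1)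

/-- On the input `l`, the program halts after `t` steps with the output `l'`. -/
def HaltsWith (P : Prog) (l l' : List ℕ) (t : ℕ) : Prop :=
  ∃ s, Exec P (State.initial l) s t ∧ s.output = l'

end RAM

/-! ### A program logic with time bounds -/

namespace RAM

/-! Greedy construction. Numbers are handed out in descending order; each goes to all still
unassigned states of the quotient that have no conflict. A conflict of `p` (`Conflict`) is a word
outside `D` that visits infinitely often `p` and otherwise only unassigned states, and whose
membership in the language of the given automaton contradicts the parity of the current number. A
total result is a solution: for a word outside `D`, the greatest priority seen infinitely often was
handed out while all states seen infinitely often were unassigned, so absence of conflict is exactly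
correctness on that word (`mem_lang_greedy_iff`).

Minimality comes from comparison with an arbitrary solution `c` whose greatest value has the parity
of the first number (`greedy_complete`). All states that a conflict word sees infinitely often share
the conflict, so they stay unassigned together. Hence the greatest value of `c` on the unassigned
states always has the parity of the current number, and a state with that value cannot have a
conflict. Each round thus removes a value of `c`, and after as many rounds as `c` has values nothing
is left. Two runs, with first numbers of different parity, cover every `c`: the better total run is
optimal, and if no run is total there is no solution.

A conflict is decidable because it can be realised by a lasso in the product of the two automata: a
loop through a state of greatest priority of the first automaton, a state of greatest and odd
priority of the second, and a state over `p` (`conflict_iff`). This is a search for three paths, and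
reachability is a fixed point found by iteration (`mem_iterate_iff_reachable`).

For the machine model, the algorithm is written as a term of a small language in which every loop
has polynomially many rounds in the length of the input. `Term.runs_compile` gives correctness and a
polynomial time bound for all terms at once; what remains is to evaluate one term (`eval_reachTerm`,
`holds_conflictTerm`, `eval_greedyTerm`). -/

/-- Started in `s`, the program halts within `T` steps in a state that satisfies `Q`. -/
def Runs (P : Prog) (s : State) (T : ℕ) (Q : State → Prop) : Prop :=
  ∃ s' t, Exec P s s' t ∧ t ≤ T ∧ Q s'

theorem Runs.mono {P : Prog} {s : State} {T T' : ℕ} {Q Q' : State → Prop} (h : Runs P s T Q)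
    (hT : T ≤ T') (hQ : ∀ s', Q s' → Q' s') : Runs P s T' Q' := by
  obtain ⟨s', t, he, ht, hq⟩ := h
  exact ⟨s', t, he, ht.trans hT, hQ _ hq⟩

theorem Runs.assign {s : State} {x : ℕ} {e : Expr} {Q : State → Prop}
    (h : Q (s.setReg x (e.eval s))) : Runs (Prog.assign x e) s (e.cost + 1) Q :=
  ⟨_, _, Exec.assign s x e, le_rfl, h⟩

theorem Runs.store {s : State} {a : ℕ} {i e : Expr} {Q : State → Prop}
    (h : Q (s.setArr a (i.eval s) (e.eval s))) :
    Runs (Prog.store a i e) s (i.cost + e.cost + 1) Q :=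
  ⟨_, _, Exec.store s a i e, le_rfl, h⟩

theorem Runs.seq {P R : Prog} {s : State} {T T' : ℕ} {Q Q' : State → Prop} (h : Runs P s T Q)
    (h' : ∀ s', Q s' → Runs R s' T' Q') : Runs (Prog.seq P R) s (T + T') Q' := by
  obtain ⟨s', t, he, ht, hq⟩ := h
  obtain ⟨s'', t', he', ht', hq'⟩ := h' s' hq
  exact ⟨s'', _, Exec.seq he he', by omega, hq'⟩

theorem Runs.ite {e : Expr} {P R : Prog} {s : State} {T : ℕ} {Q : State → Prop}
    (h : e.eval s ≠ 0 → Runs P s T Q) (h' : e.eval s = 0 → Runs R s T Q) :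
    Runs (Prog.ite e P R) s (e.cost + 1 + T) Q := by
  by_cases he : e.eval s = 0
  · obtain ⟨s', t, hx, ht, hq⟩ := h' he
    exact ⟨s', _, Exec.iteFalse he hx, by omega, hq⟩
  · obtain ⟨s', t, hx, ht, hq⟩ := h he
    exact ⟨s', _, Exec.iteTrue he hx, by omega, hq⟩

/-- Run `P` with register `x` ranging over the numbers below the content of register `0`. -/
def forLoop (x : ℕ) (P : Prog) : Prog :=
  .seq (.assign x (.const 0))
    (.loop (.minus (.reg 0) (.reg x)) (.seq P (.assign x (.plus (.reg x) (.const 1)))))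

theorem Runs.forLoop {L T x : ℕ} {P : Prog} {s : State} {Inv : ℕ → State → Prop} (hx : x ≠ 0)
    (hL : s.reg 0 = L) (h0 : Inv 0 (s.setReg x 0))
    (hstep : ∀ i < L, ∀ s, s.reg x = i → s.reg 0 = L → Inv i s →
      Runs P s T fun s' => s'.reg x = i ∧ s'.reg 0 = L ∧ Inv (i + 1) (s'.setReg x (i + 1))) :
    Runs (forLoop x P) s (6 + L * (T + 8)) fun s' => s'.reg 0 = L ∧ Inv L s' := by
  -- Induction on the number `m` of rounds left. The final failing test costs 4; each round costs 4
  -- for the test and 4 for the increment besides the body.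
  have key : ∀ m i s, i + m = L → s.reg x = i → s.reg 0 = L → Inv i s →
      Runs (.loop (.minus (.reg 0) (.reg x)) (.seq P (.assign x (.plus (.reg x) (.const 1)))))
        s (4 + m * (T + 8)) fun s' => s'.reg 0 = L ∧ Inv L s' := by
    intro m
    induction m with
    | zero =>
      intro i s hi hsx hs0 hI
      refine ⟨s, _, Exec.loopFalse ?_, ?_, hs0, ?_⟩
      · simp only [Expr.eval]; omega
      · simp [Expr.cost]
      · obtain rfl : i = L := by omega
        exact hI
    | succ m ih =>
      intro i s hi hsx hs0 hI
      obtain ⟨s', t, he, ht, h1, h2, h3⟩ := hstep i (by omega) s hsx hs0 hI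
      obtain ⟨s'', t', he', ht', h4⟩ := ih (i + 1) (s'.setReg x (i + 1)) (by omega)
        (by simp [State.setReg]) (by simpa [State.setReg, Function.update, Ne.symm hx] using h2) h3
      refine ⟨s'', _, Exec.loopTrue ?_ (Exec.seq he (Exec.assign _ _ _)) (?_ : Exec _ _ _ t'), ?_, h4⟩
      · simp only [Expr.eval]; omega
      · simpa [Expr.eval, h1] using he'
      · simp only [Expr.cost]
        have : (m + 1) * (T + 8) = m * (T + 8) + (T + 8) := by ring
        omega
  refine (Runs.seq (Q := fun s' => s' = s.setReg x 0) (Runs.assign rfl) ?_).mono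
    (T := 2 + (4 + L * (T + 8))) (by omega) fun _ h => h
  rintro s' rfl
  exact key L 0 _ (by omega) (by simp [State.setReg])
    (by simpa [State.setReg, Function.update, Ne.symm hx] using hL) h0

/-! ### A functional language of polynomial time -/

/-- Terms over numbers and square arrays. All loops range over the numbers below the length
of the input. -/
inductive Term where
  | const (v : ℕ)
  | var (x : ℕ)
  | inp (e : Term)
  | get (a : ℕ) (e f : Term)
  | plus (e f : Term)
  | minus (e f : Term)
  | half (e : Term)
  | cond (c e f : Term)
  | sum (x : ℕ) (e : Term)
  | iter (a x y : ℕ) (e f : Term)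

/-- The value of a term, where `L` is the length of the input, `w` the input, `ρ` the values of
the variables, and `σ` those of the arrays. The term `iter a x y e f` has the value of `f` for `a`
the array that results from the zero array in `L * L` rounds of the update `a[x, y] := e`. -/
def Term.eval (L : ℕ) (w : ℕ → ℕ) : Term → (ℕ → ℕ) → (ℕ → ℕ → ℕ → ℕ) → ℕ
  | const v, _, _ => v
  | var x, ρ, _ => ρ x
  | inp e, ρ, σ => w (e.eval L w ρ σ)
  | get a e f, ρ, σ =>
    if e.eval L w ρ σ < L ∧ f.eval L w ρ σ < L then σ a (e.eval L w ρ σ) (f.eval L w ρ σ) else 0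
  | plus e f, ρ, σ => e.eval L w ρ σ + f.eval L w ρ σ
  | minus e f, ρ, σ => e.eval L w ρ σ - f.eval L w ρ σ
  | half e, ρ, σ => e.eval L w ρ σ / 2
  | cond c e f, ρ, σ => if c.eval L w ρ σ ≠ 0 then e.eval L w ρ σ else f.eval L w ρ σ
  | sum x e, ρ, σ => ∑ v ∈ Finset.range L, e.eval L w (Function.update ρ x v) σ
  | iter a x y e f, ρ, σ =>
    f.eval L w ρ (Function.update σ a ((fun A u v =>
      e.eval L w (Function.update (Function.update ρ x u) y v) (Function.update σ a A))^[L * L]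
        fun _ _ => 0))

/-- The address of a cell of a square array. Array `2` holds the multiples of the side length. -/
def cell (x y : ℕ) : Expr := .plus (.get 2 (.reg x)) (.reg y)

/-- For all `x` and `y`, run `P` and store register `r` in the cell with address `cell x y`. -/
def fill (b x y r : ℕ) (P : Prog) : Prog :=
  forLoop x (forLoop y (.seq P (.store b (cell x y) (.reg r))))

/-- Compile a term to a program that puts the value in register `t`. The variable `x` is kept in
register `ν x` and the array `a` in array `μ a`; the registers from `t` on and the arrays from `l`
on are free for use. -/
def Term.compile : Term → (ℕ → ℕ) → (ℕ → ℕ) → ℕ → ℕ → Prog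
  | const v, _, _, t, _ => .assign t (.const v)
  | var x, ν, _, t, _ => .assign t (.reg (ν x))
  | inp e, ν, μ, t, l => .seq (e.compile ν μ t l) (.assign t (.get 0 (.reg t)))
  | get a e f, ν, μ, t, l =>
    .seq (e.compile ν μ t l) (.seq (f.compile ν μ (t + 1) l)
      (.ite (.minus (.reg 0) (.reg t))
        (.ite (.minus (.reg 0) (.reg (t + 1))) (.assign t (.get (μ a) (cell t (t + 1))))
          (.assign t (.const 0)))
        (.assign t (.const 0))))
  | plus e f, ν, μ, t, l =>
    .seq (e.compile ν μ t l) (.seq (f.compile ν μ (t + 1) l)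
      (.assign t (.plus (.reg t) (.reg (t + 1)))))
  | minus e f, ν, μ, t, l =>
    .seq (e.compile ν μ t l) (.seq (f.compile ν μ (t + 1) l)
      (.assign t (.minus (.reg t) (.reg (t + 1)))))
  | half e, ν, μ, t, l => .seq (e.compile ν μ t l) (.assign t (.half (.reg t)))
  | cond c e f, ν, μ, t, l =>
    .seq (c.compile ν μ t l) (.ite (.reg t) (e.compile ν μ t l) (f.compile ν μ t l))
  | sum x e, ν, μ, t, l =>
    .seq (.assign t (.const 0)) (forLoop (t + 1)
      (.seq (e.compile (Function.update ν x (t + 1)) μ (t + 2) l)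
        (.assign t (.plus (.reg t) (.reg (t + 2))))))
  | iter a x y e f, ν, μ, t, l =>
    .seq (fill l (t + 1) (t + 2) (t + 5) (.assign (t + 5) (.const 0)))
      (.seq (forLoop (t + 3) (forLoop (t + 4)
        (.seq (fill (l + 1) (t + 1) (t + 2) (t + 5)
            (e.compile (Function.update (Function.update ν x (t + 1)) y (t + 2))
              (Function.update μ a l) (t + 5) (l + 2)))
          (fill l (t + 1) (t + 2) (t + 5) (.assign (t + 5) (.get (l + 1) (cell (t + 1) (t + 2))))))))
      (f.compile ν (Function.update μ a l) t (l + 2)))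

open Polynomial in
/-- The time bound for a `fill` whose inner program has the time bound `c`. -/
noncomputable def fillCost (c : ℕ[X]) : ℕ[X] := 6 + X * (6 + X * (c + 6 + 8) + 8)

open Polynomial in
/-- A bound for the running time of the compiled term in the length of the input. -/
noncomputable def Term.cost : Term → ℕ[X]
  | const _ => 2
  | var _ => 2
  | inp e => e.cost + 3
  | get _ e f => e.cost + (f.cost + 14)
  | plus e f => e.cost + (f.cost + 4)
  | minus e f => e.cost + (f.cost + 4)
  | half e => e.cost + 3
  | cond c e f => c.cost + (2 + (e.cost + f.cost))
  | sum _ e => 2 + (6 + X * (e.cost + 4 + 8))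
  | iter _ _ _ e f => fillCost 2 +
      (6 + X * (6 + X * (fillCost e.cost + fillCost 6 + 8) + 8) + f.cost)

/-! ### Correctness and running time of compiled terms -/

/-- The registers below `t` and the arrays below `l` are the same. -/
structure Agree (t l : ℕ) (s s' : State) : Prop where
  reg : ∀ x < t, s'.reg x = s.reg x
  arr : ∀ b < l, s'.arr b = s.arr b

theorem Agree.trans {t l t' l' : ℕ} {s s' s'' : State} (h : Agree t l s s')
    (h' : Agree t' l' s' s'') (ht : t ≤ t') (hl : l ≤ l') : Agree t l s s'' :=
  ⟨fun x hx => (h'.reg x (by omega)).trans (h.reg x hx),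
    fun b hb => (h'.arr b (by omega)).trans (h.arr b hb)⟩

theorem Agree.setReg {t l x v : ℕ} {s s' : State} (h : Agree t l s s') (hx : t ≤ x) :
    Agree t l s (s'.setReg x v) :=
  ⟨fun y hy => by
    have hne : y ≠ x := by omega
    simpa [State.setReg, Function.update, hne] using h.reg y hy, h.arr⟩

theorem Agree.refl (t l : ℕ) (s : State) : Agree t l s s := ⟨fun _ _ => rfl, fun _ _ => rfl⟩

/-- The state `s` holds the input `w` and the values `ρ` of the variables and `σ` of the
arrays. -/
structure Rel (L : ℕ) (w : ℕ → ℕ) (ν μ : ℕ → ℕ) (t l : ℕ) (ρ : ℕ → ℕ) (σ : ℕ → ℕ → ℕ → ℕ)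
    (s : State) : Prop where
  pos : 0 < t
  lvl : 3 ≤ l
  len : s.reg 0 = L
  input : s.arr 0 = w
  table : ∀ i < L, s.arr 2 i = i * L
  var_lt : ∀ x, ν x < t
  var : ∀ x, s.reg (ν x) = ρ x
  arr_lt : ∀ a, μ a < l
  arr : ∀ a, ∀ i < L, ∀ j < L, s.arr (μ a) (i * L + j) = σ a i j

section

variable {L : ℕ} {w : ℕ → ℕ} {ν μ : ℕ → ℕ} {t l : ℕ} {ρ : ℕ → ℕ} {σ : ℕ → ℕ → ℕ → ℕ} {s s' : State}

theorem Rel.of_agree (h : Rel L w ν μ t l ρ σ s) (ha : Agree t l s s') :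
    Rel L w ν μ t l ρ σ s' where
  pos := h.pos
  lvl := h.lvl
  len := (ha.reg 0 h.pos).trans h.len
  input := (ha.arr 0 (by have := h.lvl; omega)).trans h.input
  table i hi := by rw [ha.arr 2 (by have := h.lvl; omega), h.table i hi]
  var_lt := h.var_lt
  var x := (ha.reg _ (h.var_lt x)).trans (h.var x)
  arr_lt := h.arr_lt
  arr a i hi j hj := by rw [ha.arr _ (h.arr_lt a), h.arr a i hi j hj]

theorem Rel.mono {t' l' : ℕ} (h : Rel L w ν μ t l ρ σ s) (ht : t ≤ t') (hl : l ≤ l') :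
    Rel L w ν μ t' l' ρ σ s where
  pos := h.pos.trans_le ht
  lvl := h.lvl.trans hl
  len := h.len
  input := h.input
  table := h.table
  var_lt x := (h.var_lt x).trans_le ht
  var := h.var
  arr_lt a := (h.arr_lt a).trans_le hl
  arr := h.arr

theorem Rel.bindVar (h : Rel L w ν μ t l ρ σ s) (x : ℕ) {r v : ℕ} (hr : r < t)
    (hv : s.reg r = v) :
    Rel L w (Function.update ν x r) μ t l (Function.update ρ x v) σ s where
  pos := h.pos
  lvl := h.lvl
  len := h.len
  input := h.input
  table := h.table
  var_lt y := by
    by_cases hy : y = x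
    · subst hy; simpa using hr
    · simpa [hy] using h.var_lt y
  var y := by
    by_cases hy : y = x
    · subst hy; simpa using hv
    · simpa [hy] using h.var y
  arr_lt := h.arr_lt
  arr := h.arr

theorem Rel.bindArr (h : Rel L w ν μ t l ρ σ s) (a : ℕ) {b : ℕ} {A : ℕ → ℕ → ℕ} (hb : b < l)
    (hA : ∀ i < L, ∀ j < L, s.arr b (i * L + j) = A i j) :
    Rel L w ν (Function.update μ a b) t l ρ (Function.update σ a A) s where
  pos := h.pos
  lvl := h.lvl
  len := h.len
  input := h.input
  table := h.table
  var_lt := h.var_lt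
  var := h.var
  arr_lt c := by
    by_cases hc : c = a
    · subst hc; simpa using hb
    · simpa [hc] using h.arr_lt c
  arr c := by
    by_cases hc : c = a
    · subst hc; simpa using hA
    · simpa [hc] using h.arr c

end

@[simp] theorem setReg_reg (s : State) (x v y : ℕ) :
    (s.setReg x v).reg y = if y = x then v else s.reg y := by
  simp [State.setReg, Function.update]

@[simp] theorem setReg_arr (s : State) (x v : ℕ) : (s.setReg x v).arr = s.arr := rfl

@[simp] theorem setArr_reg (s : State) (a i v : ℕ) : (s.setArr a i v).reg = s.reg := rfl

theorem setArr_arr (s : State) (a i v b j : ℕ) :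
    (s.setArr a i v).arr b j = if b = a ∧ j = i then v else s.arr b j := by
  by_cases hb : b = a
  · subst hb
    simp [State.setArr, Function.update]
  · simp [State.setArr, hb]

theorem cell_inj {L i j i' j' : ℕ} (hj : j < L) (hj' : j' < L) (h : i * L + j = i' * L + j') :
    i = i' ∧ j = j' := by
  have hi : i = i' := by
    have h1 : (i * L + j) / L = i := by
      rw [mul_comm, Nat.mul_add_div (by omega), Nat.div_eq_of_lt hj, add_zero]
    have h2 : (i' * L + j') / L = i' := by
      rw [mul_comm, Nat.mul_add_div (by omega), Nat.div_eq_of_lt hj', add_zero]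
    rw [← h1, h, h2]
  subst hi
  exact ⟨rfl, by omega⟩

/-- The states agree up to the array `b` and the registers `x` and `y`. -/
structure FillFrame (b x y t l : ℕ) (s s' : State) : Prop where
  reg : ∀ z < t, z ≠ x → z ≠ y → s'.reg z = s.reg z
  arr : ∀ c < l, c ≠ b → s'.arr c = s.arr c

/-- The inner program is analysed only in states that differ from the initial one in the array `b`
and the two indices, within the frame. Since `b < l`, the program itself keeps `b`, so distinct
addresses (`cell_inj`) protect the cells filled before. -/
theorem runs_fill {L T b x y r l : ℕ} {P : Prog} {s : State} (F : ℕ → ℕ → ℕ) (hx : x ≠ 0)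
    (hy : y ≠ 0) (hxy : x ≠ y) (hxr : x < r) (hyr : y < r) (hb : 2 < b) (hbl : b < l)
    (hL : s.reg 0 = L) (htab : ∀ i < L, s.arr 2 i = i * L)
    (hP : ∀ i < L, ∀ j < L, ∀ s', FillFrame b x y r l s s' → s'.reg x = i → s'.reg y = j →
      Runs P s' T fun s'' => s''.reg r = F i j ∧ Agree r l s' s'') :
    Runs (fill b x y r P) s (6 + L * (6 + L * (T + 6 + 8) + 8)) fun s' =>
      FillFrame b x y r l s s' ∧ ∀ i < L, ∀ j < L, s'.arr b (i * L + j) = F i j := by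
  refine (Runs.forLoop (Inv := fun i s' => FillFrame b x y r l s s' ∧
    ∀ i' < i, ∀ j < L, s'.arr b (i' * L + j) = F i' j) hx hL ?_ ?_).mono le_rfl
    fun s' h => h.2
  · refine ⟨⟨fun z _ h1 _ => by simp [h1], fun c _ _ => rfl⟩, by simp⟩
  intro i hi s1 h1x h1L ⟨h1F, h1A⟩
  refine (Runs.forLoop (Inv := fun j s' => s'.reg x = i ∧ FillFrame b x y r l s s' ∧
    (∀ i' < i, ∀ j < L, s'.arr b (i' * L + j) = F i' j) ∧
    ∀ j' < j, s'.arr b (i * L + j') = F i j') hy h1L ?_ ?_).mono le_rfl ?_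
  · refine ⟨by simp [hxy, h1x], ⟨fun z hz h2 h3 => ?_, h1F.arr⟩, h1A, by simp⟩
    simpa [h3] using h1F.reg z hz h2 h3
  · intro j hj s2 h2y h2L ⟨h2x, h2F, h2A, h2B⟩
    refine Runs.seq (T' := 6) (hP i hi j hj s2 h2F h2x h2y) fun s3 ⟨h3r, h3⟩ => ?_
    have e3x : s3.reg x = i := (h3.reg x hxr).trans h2x
    have e3y : s3.reg y = j := (h3.reg y hyr).trans h2y
    have e3c : (cell x y).eval s3 = i * L + j := by
      simp only [cell, Expr.eval, e3x, e3y]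
      rw [h3.arr 2 (by omega), h2F.arr 2 (by omega) (by omega), htab i hi]
    refine Runs.mono (T := (cell x y).cost + 1 + 1) (Runs.store (Q := fun s' => _) ?_) le_rfl
      fun s' h => h
    simp only [setArr_reg]
    have e30 : s3.reg 0 = L := (h3.reg 0 (by omega)).trans h2L
    refine ⟨e3y, e30, ?_, ⟨?_, ?_⟩, ?_, ?_⟩
    · simp [hxy, e3x]
    · intro z hz h4 h5
      simp [h5, h3.reg z hz, h2F.reg z hz h4 h5]
    · intro c hc hcb
      funext i'
      simp [setArr_arr, hcb, h3.arr c hc, h2F.arr c hc hcb]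
    · intro i' hi' j' hj'
      have : i' * L + j' ≠ i * L + j := fun h => by
        have := (cell_inj hj' hj h).1; omega
      simp only [setReg_arr, setArr_arr, e3c, this, and_false, if_false]
      rw [h3.arr b hbl, h2A i' hi' j' hj']
    · intro j' hj'
      rcases Nat.lt_succ_iff_lt_or_eq.mp hj' with h | rfl
      · have : j' ≠ j := by omega
        simp only [setReg_arr, setArr_arr, e3c, add_right_inj, this, and_false, if_false]
        rw [h3.arr b hbl, h2B j' h]
      · simp only [setReg_arr, setArr_arr, e3c, and_self, if_true]
        simpa [Expr.eval] using h3r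
  · intro s2 ⟨h2L, h2x, h2F, h2A, h2B⟩
    refine ⟨h2x, h2L, ⟨fun z hz h3 h4 => ?_, h2F.arr⟩, ?_⟩
    · simpa [h3] using h2F.reg z hz h3 h4
    · intro i' hi' j hj
      rcases Nat.lt_succ_iff_lt_or_eq.mp hi' with h | rfl
      · exact h2A i' h j hj
      · exact h2B j hj

/-- Compiled terms run in polynomial time, compute the value of the term and keep what is in
use. -/
theorem Term.runs_compile {L : ℕ} {w : ℕ → ℕ} (e : Term) :
    ∀ {ν μ : ℕ → ℕ} {t l : ℕ} {ρ : ℕ → ℕ} {σ : ℕ → ℕ → ℕ → ℕ} {s : State},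
      Rel L w ν μ t l ρ σ s → Runs (e.compile ν μ t l) s (e.cost.eval L) fun s' =>
        s'.reg t = e.eval L w ρ σ ∧ Agree t l s s' := by
  induction e with
  | const v =>
    intro ν μ t l ρ σ s h
    simp only [compile, cost, Polynomial.eval_ofNat]
    exact Runs.assign ⟨by simp [Expr.eval, Term.eval], (Agree.refl _ _ _).setReg le_rfl⟩
  | var x =>
    intro ν μ t l ρ σ s h
    simp only [compile, cost, Polynomial.eval_ofNat]
    exact Runs.assign ⟨by simp [Expr.eval, Term.eval, h.var], (Agree.refl _ _ _).setReg le_rfl⟩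
  | inp e ih =>
    intro ν μ t l ρ σ s h
    simp only [compile, cost, Polynomial.eval_add, Polynomial.eval_ofNat]
    refine Runs.seq (ih h) fun s1 ⟨h1, a1⟩ => Runs.assign (e := .get 0 (.reg t)) ⟨?_, a1.setReg le_rfl⟩
    simp [Expr.eval, Term.eval, h1, (h.of_agree a1).input]
  | half e ih =>
    intro ν μ t l ρ σ s h
    simp only [compile, cost, Polynomial.eval_add, Polynomial.eval_ofNat]
    refine Runs.seq (ih h) fun s1 ⟨h1, a1⟩ => Runs.assign (e := .half (.reg t)) ⟨?_, a1.setReg le_rfl⟩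
    simp [Expr.eval, Term.eval, h1]
  | plus e f ihe ihf =>
    intro ν μ t l ρ σ s h
    simp only [compile, cost, Polynomial.eval_add, Polynomial.eval_ofNat]
    refine Runs.seq (ihe h) fun s1 ⟨h1, a1⟩ =>
      Runs.seq (ihf ((h.of_agree a1).mono (Nat.le_succ t) le_rfl)) fun s2 ⟨h2, a2⟩ =>
        Runs.assign (e := .plus (.reg t) (.reg (t + 1)))
          ⟨?_, (a1.trans a2 (Nat.le_succ t) le_rfl).setReg le_rfl⟩
    simp [Expr.eval, Term.eval, h1, h2, a2.reg t (Nat.lt_succ_self t)]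
  | minus e f ihe ihf =>
    intro ν μ t l ρ σ s h
    simp only [compile, cost, Polynomial.eval_add, Polynomial.eval_ofNat]
    refine Runs.seq (ihe h) fun s1 ⟨h1, a1⟩ =>
      Runs.seq (ihf ((h.of_agree a1).mono (Nat.le_succ t) le_rfl)) fun s2 ⟨h2, a2⟩ =>
        Runs.assign (e := .minus (.reg t) (.reg (t + 1)))
          ⟨?_, (a1.trans a2 (Nat.le_succ t) le_rfl).setReg le_rfl⟩
    simp [Expr.eval, Term.eval, h1, h2, a2.reg t (Nat.lt_succ_self t)]
  | get a e f ihe ihf =>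
    intro ν μ t l ρ σ s h
    simp only [compile, cost, Polynomial.eval_add, Polynomial.eval_ofNat]
    refine Runs.seq (ihe h) fun s1 ⟨h1, a1⟩ =>
      Runs.seq (ihf ((h.of_agree a1).mono (Nat.le_succ t) le_rfl)) fun s2 ⟨h2, a2⟩ => ?_
    have a3 := a1.trans a2 (Nat.le_succ t) le_rfl
    have h3 := h.of_agree a3
    have h1' : s2.reg t = e.eval L w ρ σ := (a2.reg t (Nat.lt_succ_self t)).trans h1
    have hlen := h3.len
    -- The machine mirrors only the cells with both indices below `L`; the two tests give the value
    -- 0 to every other access, as the semantics demands.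
    refine Runs.ite (e := .minus (.reg 0) (.reg t)) (T := 10) (fun c1 =>
      Runs.ite (e := .minus (.reg 0) (.reg (t + 1))) (T := 6) (fun c2 => ?_) fun c2 => ?_) fun c1 => ?_
    · simp only [Expr.eval, h1', h2, hlen] at c1 c2
      refine Runs.assign (e := .get (μ a) (cell t (t + 1))) ⟨?_, a3.setReg le_rfl⟩
      have := h3.arr a (e.eval L w ρ σ) (by omega) (f.eval L w ρ σ) (by omega)
      simp only [setReg_reg, if_true, cell, Expr.eval, h1', h2, Term.eval]
      rw [h3.table _ (by omega), this, if_pos (by omega)]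
    · simp only [Expr.eval, h1', h2, hlen] at c1 c2
      refine (Runs.assign (Q := fun _ => _) ⟨?_, a3.setReg le_rfl⟩).mono (by simp [Expr.cost])
        fun _ h => h
      simp only [setReg_reg, if_true, Expr.eval, Term.eval]
      rw [if_neg (by omega)]
    · simp only [Expr.eval, h1', hlen] at c1
      refine (Runs.assign (Q := fun _ => _) ⟨?_, a3.setReg le_rfl⟩).mono (by simp [Expr.cost])
        fun _ h => h
      simp only [setReg_reg, if_true, Expr.eval, Term.eval]
      rw [if_neg (by omega)]
  | cond c e f ihc ihe ihf =>
    intro ν μ t l ρ σ s h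
    simp only [compile, cost, Polynomial.eval_add, Polynomial.eval_ofNat]
    refine Runs.seq (ihc h) fun s1 ⟨h1, a1⟩ => Runs.ite (e := .reg t) (fun c1 => ?_) fun c1 => ?_
    · refine (ihe (h.of_agree a1)).mono (Nat.le_add_right _ _) fun s2 ⟨h2, a2⟩ =>
        ⟨?_, a1.trans a2 le_rfl le_rfl⟩
      simp only [Expr.eval, h1] at c1
      rw [h2, Term.eval, if_pos c1]
    · refine (ihf (h.of_agree a1)).mono (Nat.le_add_left _ _) fun s2 ⟨h2, a2⟩ =>
        ⟨?_, a1.trans a2 le_rfl le_rfl⟩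
      simp only [Expr.eval, h1] at c1
      rw [h2, Term.eval, if_neg (by simpa using c1)]
  | sum x e ih =>
    intro ν μ t l ρ σ s h
    simp only [compile, cost, Polynomial.eval_add, Polynomial.eval_mul, Polynomial.eval_X,
      Polynomial.eval_ofNat]
    have ht := h.pos
    have ht0 : 0 ≠ t := by omega
    refine Runs.seq (Q := fun s' => s' = s.setReg t 0) (T := 2) (Runs.assign rfl) ?_
    rintro _ rfl
    refine (Runs.forLoop (L := L) (T := e.cost.eval L + 4) (Inv := fun i s' =>
      s'.reg t = ∑ v ∈ Finset.range i, e.eval L w (Function.update ρ x v) σ ∧ Agree t l s s')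
      (by omega) ?_ ?_ ?_).mono le_rfl fun s' h' => ⟨h'.2.1, h'.2.2⟩
    · simpa [ht0] using h.len
    · exact ⟨by simp, ((Agree.refl _ _ _).setReg le_rfl).setReg (by omega)⟩
    · intro i hi s1 h1x h1L ⟨h1s, a1⟩
      have hR := (((h.of_agree a1).mono (t' := t + 2) (by omega) le_rfl)).bindVar x
        (r := t + 1) (by omega) h1x
      refine Runs.seq (ih hR) fun s2 ⟨h2, a2⟩ =>
        Runs.assign (e := .plus (.reg t) (.reg (t + 2))) ⟨?_, ?_, ?_, ?_⟩
      · simpa [a2.reg (t + 1) (by omega)] using h1x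
      · simpa [ht0, a2.reg 0 (by omega)] using h1L
      · simp [Expr.eval, Finset.sum_range_succ, a2.reg t (by omega), h1s, h2]
      · exact ((a1.trans a2 (by omega) le_rfl).setReg le_rfl).setReg (by omega)
  | iter a x y e f ihe ihf =>
    intro ν μ t l ρ σ s h
    simp only [compile, cost, fillCost, Polynomial.eval_add, Polynomial.eval_mul,
      Polynomial.eval_X, Polynomial.eval_ofNat]
    have ht := h.pos
    have hl := h.lvl
    set G : (ℕ → ℕ → ℕ) → ℕ → ℕ → ℕ := fun A u v =>
      e.eval L w (Function.update (Function.update ρ x u) y v) (Function.update σ a A) with hG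
    refine Runs.seq (runs_fill (l := l + 2) (T := 2) (fun _ _ => 0) (by omega) (by omega)
      (by omega) (by omega) (by omega) (by omega) (by omega) h.len h.table
      fun i _ j _ s' _ _ _ =>
        Runs.assign ⟨by simp [Expr.eval], (Agree.refl _ _ _).setReg le_rfl⟩)
      fun s1 ⟨f1, h1⟩ => ?_
    have a1 : Agree (t + 1) l s s1 :=
      ⟨fun z hz => f1.reg z (by omega) (by omega) (by omega),
        fun c hc => f1.arr c (by omega) (by omega)⟩
    refine Runs.seq (Q := fun s' => Agree t l s s' ∧
      ∀ i < L, ∀ j < L, s'.arr l (i * L + j) = G^[L * L] (fun _ _ => 0) i j) ?_ ?_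
    · refine (Runs.forLoop (L := L) (Inv := fun m s' => Agree t l s s' ∧
        ∀ i < L, ∀ j < L, s'.arr l (i * L + j) = G^[m * L] (fun _ _ => 0) i j)
        (by omega) ?_ ?_ ?_).mono le_rfl fun s' h' => h'.2
      · rw [a1.reg 0 (by omega), h.len]
      · exact ⟨((Agree.refl t l s).trans a1 (Nat.le_succ t) le_rfl).setReg (by omega),
          fun i hi j hj => by simpa using h1 i hi j hj⟩
      intro m hm s2 h2x h2L ⟨a2, h2⟩
      refine (Runs.forLoop (L := L) (Inv := fun m' s' => s'.reg (t + 3) = m ∧ Agree t l s s' ∧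
        ∀ i < L, ∀ j < L, s'.arr l (i * L + j) = G^[m * L + m'] (fun _ _ => 0) i j)
        (by omega) h2L ?_ ?_).mono le_rfl ?_
      · exact ⟨by simpa using h2x, a2.setReg (by omega),
          fun i hi j hj => by simpa using h2 i hi j hj⟩
      · intro m' hm' s3 h3x h3L ⟨h3m, a3, h3⟩
        have hR3 := h.of_agree a3
        -- One round updates all cells simultaneously: the new values go to the buffer `l + 1` while
        -- the old array `l` is still being read, and are then copied back.
        refine Runs.seq (runs_fill (l := l + 2) (L := L) (G (G^[m * L + m'] (fun _ _ => 0))) (by omega)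
          (by omega) (by omega) (by omega) (by omega) (by omega) (by omega) h3L hR3.table
          fun i hi j hj s' f' hx' hy' => ?_) fun s4 ⟨f4, h4⟩ => ?_
        · have a' : Agree (t + 1) (l + 1) s3 s' :=
            ⟨fun z hz => f'.reg z (by omega) (by omega) (by omega),
              fun c hc => f'.arr c (by omega) (by omega)⟩
          have hR' := ((hR3.mono (t' := t + 1) (l' := l + 1) (by omega) (by omega)).of_agree a').mono
            (t' := t + 5) (l' := l + 2) (by omega) (by omega)
          exact ihe (((hR'.bindVar x (r := t + 1) (by omega) hx').bindVar y (r := t + 2)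
            (by omega) hy').bindArr a (b := l) (by omega)
            fun i hi j hj => by rw [a'.arr l (by omega)]; exact h3 i hi j hj)
        · have a4 : Agree t l s s4 :=
            a3.trans (t' := t + 1) (l' := l + 1) ⟨fun z hz => f4.reg z (by omega) (by omega) (by omega),
              fun c hc => f4.arr c (by omega) (by omega)⟩ (by omega) (by omega)
          have hR4 := h.of_agree a4
          refine (runs_fill (l := l + 2) (L := L) (G (G^[m * L + m'] (fun _ _ => 0))) (by omega)
            (by omega) (by omega) (by omega) (by omega) (by omega) (by omega) hR4.len hR4.table
            fun i hi j hj s' f' hx' hy' => Runs.assign (e := .get (l + 1) (cell (t + 1) (t + 2)))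
              ⟨?_, (Agree.refl _ _ _).setReg le_rfl⟩).mono le_rfl fun s5 ⟨f5, h5⟩ => ?_
          · simp only [setReg_reg, if_true, Expr.eval, cell, hx', hy']
            rw [f'.arr 2 (by omega) (by omega), hR4.table i hi,
              f'.arr (l + 1) (by omega) (by omega), h4 i hi j hj]
          · refine ⟨?_, ?_, ?_, ?_, ?_⟩
            · rw [f5.reg _ (by omega) (by omega) (by omega),
                f4.reg _ (by omega) (by omega) (by omega), h3x]
            · rw [f5.reg _ (by omega) (by omega) (by omega), hR4.len]
            · simp only [setReg_reg]
              rw [if_neg (by omega), f5.reg _ (by omega) (by omega) (by omega),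
                f4.reg _ (by omega) (by omega) (by omega), h3m]
            · exact Agree.setReg (a4.trans (t' := t + 1) (l' := l)
                ⟨fun z hz => f5.reg z (by omega) (by omega) (by omega),
                fun c hc => f5.arr c (by omega) (by omega)⟩ (by omega) (by omega)) (by omega)
            · intro i hi j hj
              rw [← add_assoc, Function.iterate_succ_apply']
              exact h5 i hi j hj
      · intro s3 ⟨h3L, h3m, a3, h3⟩
        refine ⟨h3m, h3L, a3.setReg (by omega), fun i hi j hj => ?_⟩
        rw [Nat.succ_mul]
        exact h3 i hi j hj
    · intro s2 ⟨a2, h2⟩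
      refine (ihf (((h.of_agree a2).mono (l' := l + 2) le_rfl (by omega)).bindArr a (b := l)
        (by omega) h2)).mono le_rfl fun s3 ⟨h3, a3⟩ => ⟨h3, a2.trans a3 le_rfl (by omega)⟩

end RAM

/-! ### Programs that print a list of values -/

namespace RAM

/-- The program that outputs the values of `e` for the values `0, 1, 2, …` of the variable `1`,
as many of them as the value of `f` says. -/
def outputProg (e f : Term) : Prog :=
  .seq (forLoop 1 (.seq (.store 2 (.reg 1) (.reg 2)) (.assign 2 (.plus (.reg 2) (.reg 0)))))
    (.seq (forLoop 1 (.seq (e.compile (Function.update (fun _ => 0) 1 1) (fun _ => 3) 2 4)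
        (.store 1 (.reg 1) (.reg 2))))
      (.seq (f.compile (fun _ => 0) (fun _ => 3) 2 4) (.assign 0 (.reg 2))))

open Polynomial in
/-- A time bound for `outputProg` in the length of the input. -/
noncomputable def outputCost (e f : Term) : ℕ[X] :=
  6 + X * (7 + 8) + (6 + X * (e.cost + 3 + 8) + (f.cost + 2))

theorem haltsWith_outputProg (e f : Term) (inp : List ℕ)
    (hf : f.eval inp.length (inp.getD · 0) (fun _ => inp.length) (fun _ _ _ => 0) ≤ inp.length) :
    ∃ t ≤ (outputCost e f).eval inp.length, HaltsWith (outputProg e f) inp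
      ((List.range (f.eval inp.length (inp.getD · 0) (fun _ => inp.length) fun _ _ _ => 0)).map
        fun p => e.eval inp.length (inp.getD · 0) (Function.update (fun _ => inp.length) 1 p)
          fun _ _ _ => 0) t := by
  set L := inp.length with hL
  set w : ℕ → ℕ := (inp.getD · 0) with hw
  set σ : ℕ → ℕ → ℕ → ℕ := fun _ _ _ => 0 with hσ
  set N := f.eval L w (fun _ => L) σ with hN
  set V : ℕ → ℕ := fun p => e.eval L w (Function.update (fun _ => L) 1 p) σ with hV
  suffices h : Runs (outputProg e f) (State.initial inp) ((outputCost e f).eval L) fun s' =>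
      s'.reg 0 = N ∧ ∀ p < N, s'.arr 1 p = V p by
    obtain ⟨s', t, he, ht, h0, h1⟩ := h
    refine ⟨t, ht, s', he, ?_⟩
    rw [State.output, h0]
    exact List.map_congr_left fun p hp => h1 p (List.mem_range.mp hp)
  simp only [outputProg, outputCost, Polynomial.eval_add, Polynomial.eval_mul, Polynomial.eval_X,
    Polynomial.eval_ofNat]
  have hi0 : (State.initial inp).reg 0 = L := by simp [State.initial, hL]
  -- The multiples of `L` are tabulated by repeated addition, register 2 being the accumulator.
  refine Runs.seq (Runs.forLoop (L := L) (T := 7) (Inv := fun i s' => s'.reg 2 = i * L ∧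
    s'.arr 0 = w ∧ s'.arr 3 = (fun _ => 0) ∧ ∀ j < i, s'.arr 2 j = j * L) (by omega) hi0 ?_ ?_)
    fun s1 ⟨h10, _, h1w, h13, h1t⟩ => ?_
  · refine ⟨by simp [State.initial], ?_, ?_, by simp⟩
    · funext i; simp [State.initial, hw]
    · funext i; simp [State.initial]
  · intro i hi s h1 h0 ⟨h2, hw', h3, ht⟩
    refine (Runs.seq (T := 3) (T' := 4) (Runs.store (i := .reg 1) (e := .reg 2)
      (Q := fun s' => s' = s.setArr 2 i (s.reg 2)) ?_) ?_).mono le_rfl fun _ h => h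
    · simp [Expr.eval, h1]
    · rintro _ rfl
      refine Runs.assign (e := .plus (.reg 2) (.reg 0)) ⟨by simpa using h1, by simpa using h0,
        ?_, ?_, ?_, ?_⟩
      · simp [Expr.eval, h2, h0, Nat.succ_mul]
      · funext j; simp [setArr_arr, hw']
      · funext j; simp [setArr_arr, h3]
      · intro j hj
        rcases Nat.lt_succ_iff_lt_or_eq.mp hj with h | rfl
        · have : j ≠ i := by omega
          simp [setArr_arr, this, ht j h]
        · simp [setArr_arr, h2]
  -- Every variable not bound explicitly lives in register 0 and so has the value `L`; every array
  -- is the untouched array 3, which is zero.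
  have base : ∀ s' : State, s'.reg 0 = L → s'.arr 0 = w → s'.arr 3 = (fun _ => 0) →
      (∀ j < L, s'.arr 2 j = j * L) →
      Rel L w (fun _ => 0) (fun _ => 3) 2 4 (fun _ => L) σ s' := fun s' h0 hw h3 ht =>
    ⟨by omega, by omega, h0, hw, ht, fun _ => by omega, fun _ => h0, fun _ => by omega,
      fun a i _ j _ => by rw [h3]⟩
  refine Runs.seq (Runs.forLoop (L := L) (Inv := fun i s' =>
    s'.arr 0 = w ∧ s'.arr 3 = (fun _ => 0) ∧ (∀ j < L, s'.arr 2 j = j * L) ∧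
      ∀ p < i, s'.arr 1 p = V p) (by omega) h10 ⟨h1w, h13, h1t, by simp⟩ ?_)
    fun s2 ⟨h20, h2w, h23, h2t, h2V⟩ => ?_
  · intro i hi s h1 h0 ⟨hw', h3, ht, hp⟩
    refine Runs.seq (e.runs_compile ((base s h0 hw' h3 ht).bindVar 1 (by omega) h1))
      fun s3 ⟨h3V, a3⟩ => Runs.store (i := .reg 1) (e := .reg 2) ⟨?_, ?_, ?_, ?_, ?_, ?_⟩
    · simpa [a3.reg 1 (by omega)] using h1
    · simpa [a3.reg 0 (by omega)] using h0
    · funext j; simp [setArr_arr, a3.arr 0, hw']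
    · funext j; simp [setArr_arr, a3.arr 3, h3]
    · intro j hj; simp [setArr_arr, a3.arr 2, ht j hj]
    · intro p hp'
      have e1 : s3.reg 1 = i := (a3.reg 1 (by omega)).trans h1
      rcases Nat.lt_succ_iff_lt_or_eq.mp hp' with h | rfl
      · have : p ≠ i := by omega
        simp [setArr_arr, Expr.eval, e1, this, a3.arr 1, hp p h]
      · simp [setArr_arr, Expr.eval, e1, h3V, hV]
  -- The length comes last because it overwrites register 0, the bound of all loops.
  · refine Runs.seq (f.runs_compile (base s2 h20 h2w h23 h2t)) fun s3 ⟨h3, a3⟩ =>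
      Runs.assign (e := .reg 2) ⟨?_, ?_⟩
    · simp [Expr.eval, h3, hN]
    · intro p hp
      simp [a3.arr 1, h2V p (by omega)]

end RAM

/-! ### Infinity sets, lassos and conflicts in the product -/

namespace DontCare

open Relation

section Infs

variable {A Q Q' : Type*} {T : TransSystem A Q} {T' : TransSystem A Q'} {g : Q → Q'}

theorem IsHom.run_map (hg : IsHom T T' g) (α : ℕ → A) (i : ℕ) : T'.run α i = g (T.run α i) := by
  induction i with
  | zero => exact hg.map_init.symm
  | succ i ih => simp only [TransSystem.run, ih, hg.map_step]

theorem TransSystem.mem_infs_iff {α : ℕ → A} {q : Q} :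
    q ∈ T.infs α ↔ ∀ N, ∃ i, N ≤ i ∧ T.run α i = q := by
  rw [TransSystem.infs, Set.mem_ofPred_eq, ← Nat.frequently_atTop_iff_infinite,
    Filter.frequently_atTop]

/-- Each state outside the infinity set has a last visit, and there are finitely many of them. -/
theorem TransSystem.eventually_mem_infs [Finite Q] (T : TransSystem A Q) (α : ℕ → A) :
    ∃ N, ∀ i, N ≤ i → T.run α i ∈ T.infs α := by
  have h : ∀ q : Q, ∃ N, q ∈ T.infs α ∨ ∀ i, N ≤ i → T.run α i ≠ q := by
    intro q
    by_cases hq : q ∈ T.infs α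
    · exact ⟨0, Or.inl hq⟩
    · rw [TransSystem.mem_infs_iff] at hq
      push Not at hq
      obtain ⟨N, hN⟩ := hq
      exact ⟨N, Or.inr hN⟩
  choose N hN using h
  obtain ⟨B, hB⟩ := (Set.finite_range N).bddAbove
  refine ⟨B, fun i hi => ?_⟩
  rcases hN (T.run α i) with h | h
  · exact h
  · exact absurd rfl (h i ((hB ⟨_, rfl⟩).trans hi))

theorem TransSystem.infs_nonempty [Finite Q] (T : TransSystem A Q) (α : ℕ → A) :
    (T.infs α).Nonempty := by
  obtain ⟨N, hN⟩ := T.eventually_mem_infs α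
  exact ⟨_, hN N le_rfl⟩

/-- Finiteness is needed for the inclusion from left to right: the run upstairs must settle in its
infinity set, so that late visits downstairs have preimages there. -/
theorem IsHom.infs_eq [Finite Q] (hg : IsHom T T' g) (α : ℕ → A) :
    T'.infs α = g '' T.infs α := by
  ext q
  constructor
  · intro hq
    obtain ⟨N, hN⟩ := T.eventually_mem_infs α
    obtain ⟨i, hi, rfl⟩ := TransSystem.mem_infs_iff.mp hq N
    exact ⟨_, hN i hi, (hg.run_map α i).symm⟩
  · rintro ⟨p, hp, rfl⟩
    refine TransSystem.mem_infs_iff.mpr fun N => ?_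
    obtain ⟨i, hi, rfl⟩ := TransSystem.mem_infs_iff.mp hp N
    exact ⟨i, hi, hg.run_map α i⟩

theorem TransSystem.exists_max_infs [Finite Q] (T : TransSystem A Q) (c : Q → ℕ) (α : ℕ → A) :
    ∃ q ∈ T.infs α, ∀ q' ∈ T.infs α, c q' ≤ c q :=
  Set.exists_max_image _ c (Set.toFinite _) (T.infs_nonempty α)

theorem DPA.mem_lang_iff {M : DPA A Q} {α : ℕ → A} {q : Q} (hq : q ∈ M.toTS.infs α)
    (hmax : ∀ q' ∈ M.toTS.infs α, M.prio q' ≤ M.prio q) : α ∈ M.lang ↔ Even (M.prio q) := by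
  have hg : IsGreatest (M.prio '' M.toTS.infs α) (M.prio q) :=
    ⟨⟨q, hq, rfl⟩, by rintro _ ⟨q', hq', rfl⟩; exact hmax q' hq'⟩
  constructor
  · rintro ⟨m, hm, he⟩
    rwa [hg.unique hm]
  · exact fun h => ⟨_, hg, h⟩

end Infs

section Walks

variable {A V : Type*} {T : TransSystem A V}

/-- The word `l` leads from `u` to `v`, and all states after the first satisfy `ok`. -/
structure TransSystem.Walk (T : TransSystem A V) (ok : V → Prop) (u : V) (l : List A) (v : V) :
    Prop where
  eq : l.foldl T.step u = v
  ok : ∀ l', l' ≠ [] → l' <+: l → ok (l'.foldl T.step u)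

/-- There is a transition from `u` to the state `v` that satisfies `ok`. -/
def TransSystem.Edge (T : TransSystem A V) (ok : V → Prop) (u v : V) : Prop :=
  ∃ a, T.step u a = v ∧ ok v

theorem TransSystem.Walk.append {ok : V → Prop} {u v w : V} {l m : List A} (h : T.Walk ok u l v)
    (h' : T.Walk ok v m w) : T.Walk ok u (l ++ m) w where
  eq := by rw [List.foldl_append, h.eq, h'.eq]
  ok := by
    rintro l' hne ⟨r, hr⟩
    rcases List.append_eq_append_iff.mp hr with ⟨x, hx, -⟩ | ⟨x, rfl, hx⟩
    · exact h.ok l' hne ⟨x, hx.symm⟩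
    · rcases eq_or_ne x [] with rfl | hx'
      · exact h.ok _ hne (by simp)
      · rw [List.foldl_append, h.eq]
        exact h'.ok x hx' ⟨r, hx.symm⟩

theorem TransSystem.exists_walk {ok : V → Prop} {u v : V} (h : ReflTransGen (T.Edge ok) u v) :
    ∃ l, T.Walk ok u l v := by
  induction h with
  | refl => exact ⟨[], rfl, fun l' hne hl => absurd (List.prefix_nil.mp hl) hne⟩
  | tail _ hvw ih =>
    obtain ⟨l, hl⟩ := ih
    obtain ⟨a, ha, hok⟩ := hvw
    refine ⟨l ++ [a], hl.append ⟨ha, fun l' hne hl' => ?_⟩⟩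
    rw [List.prefix_cons_iff] at hl'
    rcases hl' with rfl | ⟨t, rfl, ht⟩
    · exact absurd rfl hne
    · rw [List.prefix_nil.mp ht]
      simpa [ha] using hok

theorem TransSystem.reflTransGen_run {ok : V → Prop} {α : ℕ → A} {i j : ℕ} (hij : i ≤ j)
    (hok : ∀ m, i ≤ m → ok (T.run α m)) : ReflTransGen (T.Edge ok) (T.run α i) (T.run α j) := by
  induction j, hij using Nat.le_induction with
  | base => exact .refl
  | succ j hj ih => exact ih.tail ⟨α j, rfl, hok _ (by omega)⟩

/-- The ultimately periodic word `u l l l …`. -/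
theorem TransSystem.exists_lasso {u l : List A} {w : V} (hu : u.foldl T.step T.init = w)
    (hl : l.foldl T.step w = w) (hne : l ≠ []) :
    ∃ α : ℕ → A, T.infs α = {v | ∃ l', l' ≠ [] ∧ l' <+: l ∧ l'.foldl T.step w = v} := by
  have a0 : A := l.head hne
  have hpos : 0 < l.length := List.length_pos_iff.mpr hne
  let α : ℕ → A := fun i =>
    if i < u.length then u.getD i a0 else l.getD ((i - u.length) % l.length) a0
  have h1 : ∀ i ≤ u.length, T.run α i = (u.take i).foldl T.step T.init := by
    intro i
    induction i with
    | zero => intro _; rfl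
    | succ i ih =>
      intro hi
      have hi' : i < u.length := hi
      rw [List.take_succ_eq_append_getElem hi', List.foldl_append, ← ih hi'.le]
      simp [TransSystem.run, α, hi']
  -- Within one copy of `l` that starts in `w`, the run follows the prefixes of `l`.
  have h2 : ∀ c, T.run α (u.length + c * l.length) = w → ∀ r ≤ l.length,
      T.run α (u.length + c * l.length + r) = (l.take r).foldl T.step w := by
    intro c hc r
    induction r with
    | zero => intro _; simpa using hc
    | succ r ih =>
      intro hr
      have hr' : r < l.length := hr
      have e1 : ¬ u.length + c * l.length + r < u.length := by omega
      have e2 : (u.length + c * l.length + r - u.length) % l.length = r := by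
        rw [add_assoc, Nat.add_sub_cancel_left, Nat.mul_add_mod_self_right, Nat.mod_eq_of_lt hr']
      rw [List.take_succ_eq_append_getElem hr', List.foldl_append, ← ih hr'.le]
      simp [TransSystem.run, α, e1, e2, hr']
  have h3 : ∀ c, T.run α (u.length + c * l.length) = w := by
    intro c
    induction c with
    | zero => rw [zero_mul, add_zero, h1 _ le_rfl, List.take_length, hu]
    | succ c ih =>
      rw [Nat.succ_mul, ← add_assoc, h2 c ih _ le_rfl, List.take_length, hl]
  refine ⟨α, Set.ext fun v => ⟨fun hv => ?_, ?_⟩⟩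
  · obtain ⟨i, hi, rfl⟩ := TransSystem.mem_infs_iff.mp hv u.length
    obtain ⟨m, rfl⟩ := Nat.exists_eq_add_of_le hi
    have hm : u.length + m = u.length + m / l.length * l.length + m % l.length := by
      rw [add_assoc, Nat.div_add_mod']
    have hlt := Nat.mod_lt m hpos
    rw [hm, h2 _ (h3 _) _ hlt.le]
    -- Only nonempty prefixes are listed, so position 0 of a copy is seen as the end of the whole
    -- word `l`.
    rcases Nat.eq_zero_or_pos (m % l.length) with h0 | h0
    · exact ⟨l, hne, List.prefix_rfl, by rw [h0, hl]; rfl⟩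
    · refine ⟨l.take (m % l.length), ?_, List.take_prefix _ _, rfl⟩
      rw [Ne, List.take_eq_nil_iff]
      exact fun h => h.elim h0.ne' hne
  · rintro ⟨l', -, hp, rfl⟩
    refine TransSystem.mem_infs_iff.mpr fun N => ⟨u.length + N * l.length + l'.length, ?_, ?_⟩
    · have := Nat.le_mul_of_pos_right N hpos
      omega
    · rw [h2 _ (h3 _) _ hp.length_le, ← List.prefix_iff_eq_take.mp hp]

end Walks

section Product

variable {A Q R Q' : Type*}

/-- The synchronous product. -/
def TransSystem.prod (T : TransSystem A Q) (U : TransSystem A R) : TransSystem A (Q × R) where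
  init := (T.init, U.init)
  step v a := (T.step v.1 a, U.step v.2 a)

theorem TransSystem.isHom_fst (T : TransSystem A Q) (U : TransSystem A R) :
    IsHom (T.prod U) T Prod.fst := ⟨rfl, fun _ _ => rfl⟩

theorem TransSystem.isHom_snd (T : TransSystem A Q) (U : TransSystem A R) :
    IsHom (T.prod U) U Prod.snd := ⟨rfl, fun _ _ => rfl⟩

/-- Some word outside of `L(D)` visits infinitely often `p` and otherwise only states in `S`, and
is not classified correctly by the priority `c`. -/
def Conflict (M : DPA A Q) (D : DPA A R) (T' : TransSystem A Q') (S : Set Q') (p : Q') (c : ℕ) :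
    Prop :=
  ∃ α, α ∉ D.lang ∧ T'.infs α ⊆ S ∧ p ∈ T'.infs α ∧ ¬ (α ∈ M.lang ↔ Even c)

/-- The states of the product that may occur on a loop in which `q` and `e` have the greatest
priorities and whose projection lies in `S`. -/
def LoopOk (M : DPA A Q) (D : DPA A R) (h : Q → Q') (S : Set Q') (q : Q) (e : R) (v : Q × R) :
    Prop :=
  h v.1 ∈ S ∧ M.prio v.1 ≤ M.prio q ∧ D.prio v.2 ≤ D.prio e

/-- Late enough, a run of the product stays in its infinity set and returns to each of its states,
which gives the loop; conversely the loop, repeated forever, is a witness. The state `e` is merely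
the companion of `q`, whereas `e₁` carries the greatest priority of the second automaton; these may
occur at different moments. -/
theorem conflict_iff [Finite Q] [Finite R] {M : DPA A Q} {D : DPA A R} {T' : TransSystem A Q'}
    {h : Q → Q'} (hom : IsHom M.toTS T' h) {S : Set Q'} {p : Q'} {c : ℕ} :
    Conflict M D T' S p c ↔ ∃ (q : Q) (e e₁ : R) (a : A),
      ¬ Even (D.prio e₁) ∧ ¬ (Even (M.prio q) ↔ Even c) ∧
      ReflTransGen ((M.toTS.prod D.toTS).Edge fun _ => True) (M.toTS.prod D.toTS).init (q, e) ∧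
      LoopOk M D h S q e₁ ((M.toTS.prod D.toTS).step (q, e) a) ∧
      ∃ u₁ u₂ : Q × R,
        ReflTransGen ((M.toTS.prod D.toTS).Edge (LoopOk M D h S q e₁))
          ((M.toTS.prod D.toTS).step (q, e) a) u₁ ∧ u₁.2 = e₁ ∧
        ReflTransGen ((M.toTS.prod D.toTS).Edge (LoopOk M D h S q e₁)) u₁ u₂ ∧ h u₂.1 = p ∧
        ReflTransGen ((M.toTS.prod D.toTS).Edge (LoopOk M D h S q e₁)) u₂ (q, e) := by
  set P := M.toTS.prod D.toTS with hP
  have hM : ∀ α, M.toTS.infs α = Prod.fst '' P.infs α :=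
    (TransSystem.isHom_fst M.toTS D.toTS).infs_eq
  have hD : ∀ α, D.toTS.infs α = Prod.snd '' P.infs α :=
    (TransSystem.isHom_snd M.toTS D.toTS).infs_eq
  constructor
  · rintro ⟨α, hαD, hS, hp, hc⟩
    obtain ⟨q, hq, hqmax⟩ := M.toTS.exists_max_infs M.prio α
    obtain ⟨e₁, he, hemax⟩ := D.toTS.exists_max_infs D.prio α
    rw [DPA.mem_lang_iff hq hqmax] at hc
    rw [DPA.mem_lang_iff he hemax] at hαD
    obtain ⟨N, hN⟩ := P.eventually_mem_infs α
    have hok : ∀ v ∈ P.infs α, LoopOk M D h S q e₁ v := fun v hv =>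
      ⟨hS (by rw [hom.infs_eq, hM]; exact ⟨_, ⟨v, hv, rfl⟩, rfl⟩),
        hqmax _ (by rw [hM]; exact ⟨v, hv, rfl⟩), hemax _ (by rw [hD]; exact ⟨v, hv, rfl⟩)⟩
    have hok' : ∀ j, N ≤ j → ∀ m, j ≤ m → LoopOk M D h S q e₁ (P.run α m) :=
      fun j hj m hm => hok _ (hN m (hj.trans hm))
    rw [hom.infs_eq, hM] at hp
    obtain ⟨_, ⟨u₂, hu₂, rfl⟩, rfl⟩ := hp
    rw [hM] at hq
    obtain ⟨⟨q, e⟩, hqe, rfl⟩ := hq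
    rw [hD] at he
    obtain ⟨u₁, hu₁, rfl⟩ := he
    -- Times `N ≤ i < i₁ ≤ i₂ ≤ i₃` of visits to `(q, e)`, `u₁`, `u₂` and `(q, e)` again.
    obtain ⟨i, hi, hri⟩ := TransSystem.mem_infs_iff.mp hqe N
    obtain ⟨i₁, hi₁, rfl⟩ := TransSystem.mem_infs_iff.mp hu₁ (i + 1)
    obtain ⟨i₂, hi₂, rfl⟩ := TransSystem.mem_infs_iff.mp hu₂ i₁
    obtain ⟨i₃, hi₃, hr₃⟩ := TransSystem.mem_infs_iff.mp hqe i₂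
    have hstep : P.step (q, e) (α i) = P.run α (i + 1) := by rw [← hri]; rfl
    refine ⟨q, e, _, α i, hαD, hc, ?_, ?_, P.run α i₁, P.run α i₂, ?_, rfl, ?_, rfl, ?_⟩
    · rw [← hri]
      exact TransSystem.reflTransGen_run (Nat.zero_le i) fun _ _ => trivial
    · rw [hstep]
      exact hok' (i + 1) (by omega) _ le_rfl
    · rw [hstep]
      exact TransSystem.reflTransGen_run hi₁ (hok' _ (by omega))
    · exact TransSystem.reflTransGen_run hi₂ (hok' _ (by omega))
    · rw [← hr₃]
      exact TransSystem.reflTransGen_run hi₃ (hok' _ (by omega))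
  · rintro ⟨q, e, e₁, a, he₁, hqc, hreach, hok, u₁, u₂, h₁, rfl, h₂, rfl, h₃⟩
    obtain ⟨u, hu⟩ := TransSystem.exists_walk hreach
    obtain ⟨l₁, w₁⟩ := TransSystem.exists_walk h₁
    obtain ⟨l₂, w₂⟩ := TransSystem.exists_walk h₂
    obtain ⟨l₃, w₃⟩ := TransSystem.exists_walk h₃
    -- The three paths may be empty; this first letter makes the loop a nonempty word.
    have w₀ : P.Walk (LoopOk M D h S q u₁.2) (q, e) [a] (P.step (q, e) a) := by
      refine ⟨rfl, fun l' hne hl' => ?_⟩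
      rw [List.prefix_cons_iff] at hl'
      rcases hl' with rfl | ⟨t, rfl, ht⟩
      · exact absurd rfl hne
      · rw [List.prefix_nil.mp ht]
        exact hok
    have w₀₁ := w₀.append w₁
    have w₀₂ := w₀₁.append w₂
    have w := w₀₂.append w₃
    obtain ⟨α, hα⟩ := P.exists_lasso hu.eq w.eq (by simp)
    have hqe : (q, e) ∈ P.infs α := by
      rw [hα]; exact ⟨_, by simp, List.prefix_rfl, w.eq⟩
    have hu₁ : u₁ ∈ P.infs α := by
      rw [hα]; exact ⟨_, by simp, by rw [List.append_assoc _ l₂]; exact List.prefix_append _ _, w₀₁.eq⟩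
    have hu₂ : u₂ ∈ P.infs α := by
      rw [hα]; exact ⟨_, by simp, List.prefix_append _ _, w₀₂.eq⟩
    have hall : ∀ v ∈ P.infs α, LoopOk M D h S q u₁.2 v := by
      rw [hα]
      rintro v ⟨l', hne, hp, rfl⟩
      exact w.ok l' hne hp
    refine ⟨α, ?_, ?_, ?_, ?_⟩
    · rw [DPA.mem_lang_iff (q := u₁.2)]
      · exact he₁
      · rw [hD]; exact ⟨_, hu₁, rfl⟩
      · rw [hD]; rintro _ ⟨v, hv, rfl⟩; exact (hall v hv).2.2
    · rw [hom.infs_eq, hM]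
      rintro _ ⟨_, ⟨v, hv, rfl⟩, rfl⟩
      exact (hall v hv).1
    · rw [hom.infs_eq, hM]
      exact ⟨_, ⟨u₂, hu₂, rfl⟩, rfl⟩
    · rw [DPA.mem_lang_iff (q := q)]
      · exact hqc
      · rw [hM]; exact ⟨_, hqe, rfl⟩
      · rw [hM]; rintro _ ⟨v, hv, rfl⟩; exact (hall v hv).2.1

end Product

end DontCare

/-! ### The greedy assignment and its optimality -/

namespace DontCare

section Greedy

variable {A Q R Q' : Type*} (M : DPA A Q) (D : DPA A R) (T' : TransSystem A Q')

open Classical in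
/-- Assign the priorities `start, start - 1, …` in rounds, each to all states without conflict
among the states that have no priority yet. The value `0` stands for no priority. -/
noncomputable def greedy (start : ℕ) : ℕ → Q' → ℕ
  | 0, _ => 0
  | j + 1, p =>
    if greedy start j p ≠ 0 then greedy start j p
    else if Conflict M D T' {p' | greedy start j p' = 0} p (start - j) then 0 else start - j

variable {M D T'} {start : ℕ}

theorem greedy_succ_of_ne_zero {j : ℕ} {p : Q'} (h : greedy M D T' start j p ≠ 0) :
    greedy M D T' start (j + 1) p = greedy M D T' start j p := by
  rw [greedy, if_pos h]

theorem greedy_of_le {j j' : ℕ} (hj : j ≤ j') {p : Q'} (h : greedy M D T' start j p ≠ 0) :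
    greedy M D T' start j' p = greedy M D T' start j p := by
  induction j', hj using Nat.le_induction with
  | base => rfl
  | succ j' _ ih => rw [greedy_succ_of_ne_zero (by rwa [ih]), ih]

/-- Values never change once nonzero. Rounds from `start` on hand out the truncated difference 0 and
so assign nothing, which gives `j < start` and makes surplus rounds harmless. -/
theorem exists_greedy_round {J : ℕ} {p : Q'} (h : greedy M D T' start J p ≠ 0) :
    ∃ j < J, j < start ∧ greedy M D T' start j p = 0 ∧ greedy M D T' start J p = start - j ∧
      ¬ Conflict M D T' {p' | greedy M D T' start j p' = 0} p (start - j) := by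
  induction J with
  | zero => exact absurd rfl h
  | succ J ih =>
    by_cases h0 : greedy M D T' start J p = 0
    · rw [greedy, if_neg (by simpa using h0)] at h ⊢
      split_ifs at h ⊢ with hc
      · exact absurd rfl h
      · exact ⟨J, by omega, by omega, h0, rfl, hc⟩
    · obtain ⟨j, hj, hrest⟩ := ih h0
      rw [greedy_succ_of_ne_zero h0]
      exact ⟨j, by omega, hrest⟩

theorem mem_lang_greedy_iff [Finite Q'] {J : ℕ} (hJ : ∀ p, greedy M D T' start J p ≠ 0)
    {α : ℕ → A} (hα : α ∉ D.lang) :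
    α ∈ DPA.lang ⟨T', greedy M D T' start J⟩ ↔ α ∈ M.lang := by
  obtain ⟨p, hp, hmax⟩ := T'.exists_max_infs (greedy M D T' start J) α
  rw [DPA.mem_lang_iff (M := ⟨T', greedy M D T' start J⟩) hp hmax]
  obtain ⟨j, hjJ, hjs, -, hpj, hc⟩ := exists_greedy_round (hJ p)
  by_contra hne
  refine hc ⟨α, hα, fun p' hp' => ?_, hp, fun h => hne ?_⟩
  -- A state assigned before round `j` would have a priority above the greatest one.
  · by_contra h0
    have h1 := hmax p' hp'
    obtain ⟨i, hi, -, -, hpi, -⟩ := exists_greedy_round h0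
    rw [greedy_of_le hjJ.le h0, hpi, hpj] at h1
    omega
  · rw [h]
    simp [hpj]

/-- For a solution `c` whose greatest priority has the parity of `start`, the greedy assignment
ends after as many rounds as `c` has priorities. -/
theorem greedy_complete [Fintype Q'] {c : Q' → ℕ}
    (hc : ∀ α, α ∉ D.lang → (α ∈ DPA.lang ⟨T', c⟩ ↔ α ∈ M.lang)) {p₀ : Q'}
    (hp₀ : ∀ p, c p ≤ c p₀) (hpar : Even (c p₀) ↔ Even start) (hstart : numPriorities c ≤ start) :
    ∀ p, greedy M D T' start (numPriorities c) p ≠ 0 := by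
  classical
  let S : ℕ → Finset Q' := fun j => Finset.univ.filter fun p => greedy M D T' start j p = 0
  have hS : ∀ j p, p ∈ S j ↔ greedy M D T' start j p = 0 := by simp [S]
  have hsub : ∀ j p, p ∈ S (j + 1) → p ∈ S j := fun j p hp => by
    rw [hS] at hp ⊢
    by_contra h
    exact h (by rwa [greedy_succ_of_ne_zero h] at hp)
  have hconf : ∀ j < start, ∀ p, p ∈ S j →
      (p ∈ S (j + 1) ↔ Conflict M D T' {p' | greedy M D T' start j p' = 0} p (start - j)) := by
    intro j hj p hp
    rw [hS] at hp ⊢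
    rw [greedy, if_neg (by simpa using hp)]
    split_ifs with h
    · simp [h]
    · simp only [h, iff_false]; omega
  -- Two invariants: the greatest value of `c` on the unassigned states has the parity of the
  -- current number, and at least `j` values of `c` are used up.
  have key : ∀ j ≤ numPriorities c, (∀ p ∈ S j, (∀ p' ∈ S j, c p' ≤ c p) →
      (Even (c p) ↔ Even (start - j))) ∧
      ((S j).Nonempty → j + ((S j).image c).card ≤ numPriorities c) := by
    intro j
    induction j with
    | zero =>
      intro _
      refine ⟨fun p _ hmax => ?_, fun _ => ?_⟩
      · have : c p = c p₀ := le_antisymm (hp₀ p) (hmax p₀ (by simp [hS, greedy]))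
        rw [this, hpar, Nat.sub_zero]
      · rw [zero_add]
        exact Finset.card_le_card (Finset.image_subset_image (Finset.subset_univ _))
    | succ j ih =>
      intro hj
      obtain ⟨ih1, ih2⟩ := ih (by omega)
      have hjs : j < start := by omega
      refine ⟨fun p hp hmax => ?_, fun hne => ?_⟩
      · obtain ⟨α, hα, hsubα, hpα, hm⟩ := (hconf j hjs p (hsub j p hp)).mp hp
        -- The word `α` is a conflict for each state in its infinity set, so that set lies in `S (j
        -- + 1)`, where `p` is maximal. Thus `c p` decides `α`, and the conflict forces its parity
        -- to differ from that of `start - j`.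
        have hall : ∀ p' ∈ T'.infs α, c p' ≤ c p := fun p' hp' => by
          refine hmax p' ((hconf j hjs p' ((hS j p').mpr (hsubα hp'))).mpr ?_)
          exact ⟨α, hα, hsubα, hp', hm⟩
        have h1 := DPA.mem_lang_iff (M := ⟨T', c⟩) hpα hall
        rw [hc α hα] at h1
        rw [h1] at hm
        have h2 : Even (start - j) ↔ ¬ Even (start - (j + 1)) := by
          rw [show start - j = start - (j + 1) + 1 by omega, Nat.even_add_one]
        dsimp only at hm
        tauto
      · obtain ⟨p₁, hp₁⟩ := hne
        have hne' : (S j).Nonempty := ⟨p₁, hsub j p₁ hp₁⟩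
        obtain ⟨p, hp, hmax⟩ := (S j).exists_max_image c hne'
        -- The greatest value of `c` on `S j` disappears: at a surviving state with this value, the
        -- conflict word would be decided by that value, which has the parity of `start - j`.
        have hlt : ((S (j + 1)).image c).card < ((S j).image c).card := by
          refine Finset.card_lt_card (Finset.ssubset_iff_subset_ne.mpr
            ⟨Finset.image_subset_image (hsub j), fun heq => ?_⟩)
          have hmem : c p ∈ (S (j + 1)).image c := by
            rw [heq]; exact Finset.mem_image_of_mem c hp
          obtain ⟨p', hp', hcp⟩ := Finset.mem_image.mp hmem
          obtain ⟨α, hα, hsubα, hpα, hm⟩ := (hconf j hjs p' (hsub j p' hp')).mp hp'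
          have hmax' : ∀ x ∈ S j, c x ≤ c p' := fun x hx => hcp ▸ hmax x hx
          have h1 := DPA.mem_lang_iff (M := ⟨T', c⟩) hpα
            fun x hx => hmax' x ((hS j x).mpr (hsubα hx))
          rw [hc α hα] at h1
          exact hm (h1.trans (ih1 p' (hsub j p' hp') hmax'))
        have := ih2 hne'
        omega
  intro p hp
  have hne : (S (numPriorities c)).Nonempty := ⟨p, (hS _ p).mpr hp⟩
  have h1 := (key _ le_rfl).2 hne
  have h2 := (hne.image c).card_pos
  omega

theorem numPriorities_greedy_le [Fintype Q'] {J : ℕ} (hJ : ∀ p, greedy M D T' start J p ≠ 0)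
    (hs : J ≤ start) : numPriorities (greedy M D T' start J) ≤ J := by
  have : Finset.univ.image (greedy M D T' start J) ⊆ Finset.Ioc (start - J) start := by
    intro v hv
    obtain ⟨p, -, rfl⟩ := Finset.mem_image.mp hv
    obtain ⟨j, hj, hjs, -, hpj, -⟩ := exists_greedy_round (hJ p)
    rw [Finset.mem_Ioc, hpj]
    omega
  refine (Finset.card_le_card this).trans ?_
  rw [Nat.card_Ioc]
  omega

end Greedy

namespace Instance

variable (I : Instance)

theorem isSolution_iff (c : Fin I.n' → ℕ) : I.IsSolution c ↔
    ∀ α, α ∉ I.DC.lang → (α ∈ DPA.lang ⟨I.T', c⟩ ↔ α ∈ I.M.lang) := by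
  simp only [IsSolution, EquivOutside, Set.ext_iff, Set.mem_sdiff]
  exact forall_congr' fun α => by tauto

/-- The greedy assignment after `J` rounds. -/
noncomputable def greedyPrio (start J : ℕ) : Fin I.n' → ℕ := greedy I.M I.DC I.T' start J

theorem isSolution_greedyPrio {start J : ℕ} (h : ∀ p, I.greedyPrio start J p ≠ 0) :
    I.IsSolution (I.greedyPrio start J) :=
  (I.isSolution_iff _).mpr fun _ hα => mem_lang_greedy_iff h hα

/-- For every solution, one of the two greedy assignments is total and at least as good. -/
theorem exists_greedyPrio_le {c : Fin I.n' → ℕ} (hc : I.IsSolution c) {start J : ℕ}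
    (hs : I.n' ≤ start) (hJ : I.n' ≤ J) : ∃ i < 2, (∀ p, I.greedyPrio (start + i) J p ≠ 0) ∧
      numPriorities (I.greedyPrio (start + i) J) ≤ numPriorities c := by
  obtain ⟨p₀, -, hp₀⟩ := Finset.univ.exists_max_image c ⟨I.T'.init, Finset.mem_univ _⟩
  have hm : numPriorities c ≤ I.n' := by
    simpa [numPriorities] using Finset.card_image_le (s := Finset.univ) (f := c)
  have hi : ∃ i < 2, (Even (c p₀) ↔ Even (start + i)) := by
    by_cases h : Even (c p₀) ↔ Even start
    · exact ⟨0, by omega, h⟩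
    · exact ⟨1, by omega, by rw [Nat.even_add_one]; tauto⟩
  obtain ⟨i, hi2, hpar⟩ := hi
  have h1 := greedy_complete ((I.isSolution_iff c).mp hc) (fun p => hp₀ p (Finset.mem_univ p)) hpar
    (by omega)
  -- The assignment is already total after `numPriorities c` rounds, so the other rounds change
  -- nothing; the short run bounds the number of priorities.
  have heq : I.greedyPrio (start + i) J = I.greedyPrio (start + i) (numPriorities c) :=
    funext fun p => greedy_of_le (hm.trans hJ) (h1 p)
  refine ⟨i, hi2, fun p => ?_, ?_⟩
  · rw [heq]; exact h1 p
  · rw [heq]; exact numPriorities_greedy_le h1 (by omega)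

end Instance

end DontCare

/-! ### The layout of the input -/

namespace DontCare

theorem length_flatMap_encodeFun {n k : ℕ} (f : Fin n → Fin k → ℕ) :
    ((List.finRange n).flatMap fun q => encodeFun (f q)).length = n * k := by
  simp [encodeFun, List.length_flatMap]

theorem getD_flatMap_encodeFun {n k : ℕ} (f : Fin n → Fin k → ℕ) (q : Fin n) (a : Fin k) :
    ((List.finRange n).flatMap fun q => encodeFun (f q)).getD (q * k + a) 0 = f q a := by
  induction n with
  | zero => exact q.elim0
  | succ n ih =>
    rw [List.finRange_succ, List.flatMap_cons, List.flatMap_map]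
    refine Fin.cases ?_ (fun q => ?_) q
    · rw [List.getD_append _ _ _ _ (by simp [encodeFun])]
      simp [encodeFun]
    · rw [List.getD_append_right _ _ _ _ (by simp [encodeFun, Nat.succ_mul]; omega)]
      have : ((q.succ : Fin (n + 1)) : ℕ) * k + a - (encodeFun (f 0)).length = q * k + a := by
        simp only [encodeFun, List.length_ofFn, Fin.val_succ, Nat.succ_mul]
        omega
      rw [this]
      exact ih (fun q => f q.succ) q

theorem getD_encodeFun {n : ℕ} (f : Fin n → ℕ) (q : Fin n) : (encodeFun f).getD q 0 = f q := by
  simp [encodeFun]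

theorem getD_middle {l l₁ l₂ l₃ : List ℕ} {m i : ℕ} (hl : l = l₁ ++ l₂ ++ l₃)
    (hm : m = l₁.length + i) (hi : i < l₂.length) : l.getD m 0 = l₂.getD i 0 := by
  subst hl hm
  rw [List.getD_append _ _ _ _ (by simpa using hi), List.getD_append_right _ _ _ _ (by omega),
    Nat.add_sub_cancel_left]

/-- The input `w` of length `L` encodes the instance `I`. -/
structure Encodes (I : Instance) (L : ℕ) (w : ℕ → ℕ) : Prop where
  length_eq : L = 7 + I.n * I.k + I.n + I.d * I.k + I.d + I.n' * I.k + I.n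
  k : w 0 = I.k
  n : w 1 = I.n
  d : w 2 = I.d
  n' : w 3 = I.n'
  initM : w 4 = I.M.toTS.init
  stepM : ∀ (q : Fin I.n) (a : Fin I.k), w (5 + q * I.k + a) = I.M.toTS.step q a
  prioM : ∀ q : Fin I.n, w (5 + I.n * I.k + q) = I.M.prio q
  initD : w (5 + I.n * I.k + I.n) = I.DC.toTS.init
  stepD : ∀ (e : Fin I.d) (a : Fin I.k), w (6 + I.n * I.k + I.n + e * I.k + a) = I.DC.toTS.step e a
  prioD : ∀ e : Fin I.d, w (6 + I.n * I.k + I.n + I.d * I.k + e) = I.DC.prio e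
  h : ∀ q : Fin I.n, w (7 + I.n * I.k + I.n + I.d * I.k + I.d + I.n' * I.k + q) = I.h q

theorem cell_lt {n k : ℕ} (q : Fin n) (a : Fin k) : (q : ℕ) * k + a < n * k := by
  have h1 : ((q : ℕ) + 1) * k ≤ n * k := Nat.mul_le_mul_right k q.2
  have := a.2
  rw [Nat.succ_mul] at h1
  omega

/-- The transition table of the quotient is skipped: by `conflict_iff` the algorithm needs only `h`.
-/
theorem Instance.encodes (I : Instance) :
    Encodes I I.encode.length (I.encode.getD · 0) where
  length_eq := by
    simp only [Instance.encode, DPA.encode, TransSystem.encode, List.length_append,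
      List.length_cons, List.length_nil, length_flatMap_encodeFun]
    simp only [encodeFun, List.length_ofFn]
    ring
  k := rfl
  n := rfl
  d := rfl
  n' := rfl
  initM := rfl
  stepM q a := by
    refine (getD_middle (l₁ := [I.k, I.n, I.d, I.n', I.M.toTS.init]) (l₂ := (List.finRange I.n).flatMap
      fun q => encodeFun fun a => (I.M.toTS.step q a : ℕ)) (i := q * I.k + a)
      (l₃ := encodeFun I.M.prio ++ I.DC.encode ++ I.T'.encode ++ encodeFun fun q => (I.h q : ℕ))
      ?_ ?_ ?_).trans (getD_flatMap_encodeFun _ q a)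
    · simp [Instance.encode, DPA.encode, TransSystem.encode]
    · simp; ring
    · rw [length_flatMap_encodeFun]; exact cell_lt q a
  prioM q := by
    refine (getD_middle (l₁ := [I.k, I.n, I.d, I.n'] ++ I.M.toTS.encode) (l₂ := encodeFun I.M.prio)
      (l₃ := I.DC.encode ++ I.T'.encode ++ encodeFun fun q => (I.h q : ℕ))
      (i := q) ?_ ?_ ?_).trans (getD_encodeFun _ q)
    · simp [Instance.encode, DPA.encode]
    · simp only [TransSystem.encode, List.length_append, List.length_cons, List.length_nil,
        length_flatMap_encodeFun]
      ring
    · simp [encodeFun]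
  initD := by
    refine (getD_middle (l₁ := [I.k, I.n, I.d, I.n'] ++ I.M.encode) (l₂ := I.DC.encode)
      (l₃ := I.T'.encode ++ encodeFun fun q => (I.h q : ℕ)) (i := 0) ?_ ?_ ?_).trans rfl
    · simp [Instance.encode]
    · simp only [DPA.encode, TransSystem.encode, List.length_append, List.length_cons,
        List.length_nil, length_flatMap_encodeFun]
      simp only [encodeFun, List.length_ofFn]
      ring
    · simp [DPA.encode, TransSystem.encode]
  stepD e a := by
    refine (getD_middle (l₁ := [I.k, I.n, I.d, I.n'] ++ I.M.encode ++ [(I.DC.toTS.init : ℕ)])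
      (l₂ := (List.finRange I.d).flatMap
        fun q => encodeFun fun a => (I.DC.toTS.step q a : ℕ)) (i := e * I.k + a)
      (l₃ := encodeFun I.DC.prio ++ I.T'.encode ++ encodeFun fun q => (I.h q : ℕ)) ?_ ?_ ?_).trans
      (getD_flatMap_encodeFun _ e a)
    · simp [Instance.encode, DPA.encode, TransSystem.encode]
    · simp only [DPA.encode, TransSystem.encode, List.length_append, List.length_cons,
        List.length_nil, length_flatMap_encodeFun]
      simp only [encodeFun, List.length_ofFn]
      ring
    · rw [length_flatMap_encodeFun]; exact cell_lt e a
  prioD e := by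
    refine (getD_middle (l₁ := [I.k, I.n, I.d, I.n'] ++ I.M.encode ++ I.DC.toTS.encode)
      (l₂ := encodeFun I.DC.prio) (l₃ := I.T'.encode ++ encodeFun fun q => (I.h q : ℕ))
      (i := e) ?_ ?_ ?_).trans (getD_encodeFun _ e)
    · simp [Instance.encode, DPA.encode]
    · simp only [DPA.encode, TransSystem.encode, List.length_append, List.length_cons,
        List.length_nil, length_flatMap_encodeFun]
      simp only [encodeFun, List.length_ofFn]
      ring
    · simp [encodeFun]
  h q := by
    refine (getD_middle (l₁ := [I.k, I.n, I.d, I.n'] ++ I.M.encode ++ I.DC.encode ++ I.T'.encode)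
      (l₂ := encodeFun fun q => (I.h q : ℕ)) (l₃ := []) (i := q) ?_ ?_ ?_).trans
      (getD_encodeFun _ q)
    · simp [Instance.encode]
    · simp only [DPA.encode, TransSystem.encode, List.length_append, List.length_cons,
        List.length_nil, length_flatMap_encodeFun]
      simp only [encodeFun, List.length_ofFn]
      ring
    · simp [encodeFun]

section

variable {I : Instance} {L : ℕ} {w : ℕ → ℕ}

theorem Encodes.n_lt (hin : Encodes I L w) : I.n < L := by have := hin.length_eq; omega

theorem Encodes.d_lt (hin : Encodes I L w) : I.d < L := by have := hin.length_eq; omega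

/-- For an empty alphabet the table of the quotient has no entries, so the bound rests on
surjectivity of `h`. The surplus 2 ensures that the first number `L - 2` is at least `I.n'`. -/
theorem Encodes.n'_lt (hin : Encodes I L w) : I.n' + 2 < L := by
  have := hin.length_eq
  have h : I.n' ≤ I.n := by simpa using Fintype.card_le_of_surjective I.h I.surj
  omega

theorem Encodes.k_lt (hin : Encodes I L w) : I.k < L := by
  have := hin.length_eq
  have : I.k ≤ I.n * I.k := Nat.le_mul_of_pos_left _ I.M.toTS.init.pos
  omega

end

theorem Instance.length_encode_le (I : Instance) : I.encode.length ≤ bitSize I.encode := by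
  unfold bitSize
  induction I.encode with
  | nil => simp
  | cons x l ih => simp only [List.length_cons, List.map_cons, List.sum_cons]; omega

end DontCare

/-! ### The algorithm as a term -/

namespace RAM.Term

variable {L : ℕ} {w : ℕ → ℕ} {ρ : ℕ → ℕ} {σ : ℕ → ℕ → ℕ → ℕ}

def lt (e f : Term) : Term := .minus f e
def not (e : Term) : Term := .minus (.const 1) e
def le (e f : Term) : Term := not (.minus e f)
def eq (e f : Term) : Term := not (.plus (.minus e f) (.minus f e))
def and (e f : Term) : Term := .cond e f (.const 0)
def or (e f : Term) : Term := .plus e f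
def odd (e : Term) : Term := .minus e (.plus (.half e) (.half e))

/-- The value of the term is nonzero. -/
def Holds (L : ℕ) (w ρ : ℕ → ℕ) (σ : ℕ → ℕ → ℕ → ℕ) (e : Term) : Prop := e.eval L w ρ σ ≠ 0

@[simp] theorem holds_lt (e f : Term) :
    (lt e f).Holds L w ρ σ ↔ e.eval L w ρ σ < f.eval L w ρ σ := by
  simp only [Holds, lt, eval]; omega

@[simp] theorem holds_not (e : Term) : (not e).Holds L w ρ σ ↔ ¬ e.Holds L w ρ σ := by
  simp only [Holds, not, eval]; omega

@[simp] theorem holds_le (e f : Term) :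
    (le e f).Holds L w ρ σ ↔ e.eval L w ρ σ ≤ f.eval L w ρ σ := by
  simp only [Holds, not, le, eval]; omega

@[simp] theorem holds_eq (e f : Term) :
    (eq e f).Holds L w ρ σ ↔ e.eval L w ρ σ = f.eval L w ρ σ := by
  simp only [Holds, not, eq, eval]; omega

@[simp] theorem holds_and (e f : Term) :
    (and e f).Holds L w ρ σ ↔ e.Holds L w ρ σ ∧ f.Holds L w ρ σ := by
  simp only [Holds, and, eval]
  split_ifs with h <;> simp [h]

@[simp] theorem holds_or (e f : Term) :
    (or e f).Holds L w ρ σ ↔ e.Holds L w ρ σ ∨ f.Holds L w ρ σ := by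
  simp only [Holds, or, eval]; omega

@[simp] theorem holds_odd (e : Term) : (odd e).Holds L w ρ σ ↔ ¬ Even (e.eval L w ρ σ) := by
  simp only [Holds, odd, eval, Nat.even_iff]; omega

@[simp] theorem holds_sum (x : ℕ) (e : Term) :
    (sum x e).Holds L w ρ σ ↔ ∃ v < L, e.Holds L w (Function.update ρ x v) σ := by
  simp [Holds, eval]

theorem eval_cond (c e f : Term) [Decidable (c.Holds L w ρ σ)] : (cond c e f).eval L w ρ σ =
    if c.Holds L w ρ σ then e.eval L w ρ σ else f.eval L w ρ σ := by
  simp only [eval]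
  exact if_congr Iff.rfl rfl rfl

/-- Bind the array `a` to the values of `e`, where `2` and `3` are the index variables. -/
def letArr (a : ℕ) (e f : Term) : Term := .iter a 2 3 e f

/-- As `e` does not depend on the arrays, every round produces the same table; `0 < L` guarantees
that there is a round. -/
theorem eval_letArr {a : ℕ} {e f : Term} (hL : 0 < L)
    (he : ∀ ρ σ σ', e.eval L w ρ σ = e.eval L w ρ σ') : (letArr a e f).eval L w ρ σ =
      f.eval L w ρ (Function.update σ a fun x y =>
        e.eval L w (Function.update (Function.update ρ 2 x) 3 y) σ) := by
  obtain ⟨m, hm⟩ : ∃ m, L * L = m + 1 :=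
    ⟨L * L - 1, by have := Nat.mul_pos hL hL; omega⟩
  rw [letArr, eval, hm, Function.iterate_succ_apply']
  congr 2
  funext x y
  exact he _ _ _

/-- The product of the value of `e`, at most the length of the input, with the first number of
the input. -/
def mulHead (e : Term) : Term := .sum 13 (.cond (.minus e (.var 13)) (.inp (.const 0)) (.const 0))

/-- Multiplication as repeated addition: `w 0` is added once for each `v` below the value of `e`. As
`v` stays below `L`, the value must be at most `L`. -/
theorem eval_mulHead {e : Term} (he : ∀ v, e.eval L w (Function.update ρ 13 v) σ = e.eval L w ρ σ)
    (hle : e.eval L w ρ σ ≤ L) : (mulHead e).eval L w ρ σ = e.eval L w ρ σ * w 0 := by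
  have h : ∀ m ≤ e.eval L w ρ σ + L, ∑ v ∈ Finset.range m,
      (if e.eval L w ρ σ - v ≠ 0 then w 0 else 0) = min m (e.eval L w ρ σ) * w 0 := by
    intro m _
    induction m with
    | zero => simp
    | succ m ih =>
      rw [Finset.sum_range_succ, ih (by omega)]
      split_ifs with h
      · rw [min_eq_left (by omega), min_eq_left (by omega), Nat.succ_mul]
      · rw [min_eq_right (by omega), min_eq_right (by omega), add_zero]
  simp only [mulHead, eval, he, Function.update_self]
  rw [h L (by omega), min_eq_right hle]

end RAM.Term

/-! ### Reachability as an iterated array update -/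

namespace DontCare

open RAM RAM.Term Relation

/-- The sets increase, and each step adds an element or the chain is constant from there on; hence
`Fintype.card V` steps reach the fixed point. -/
theorem mem_iterate_iff_reachable {V : Type*} [Fintype V] {Init : V → Prop} {r : V → V → Prop}
    {S : ℕ → Finset V} (h0 : S 0 = ∅)
    (hs : ∀ j v, v ∈ S (j + 1) ↔ Init v ∨ ∃ u ∈ S j, r u v) {N : ℕ} (hN : Fintype.card V ≤ N)
    (v : V) : v ∈ S N ↔ ∃ u, Init u ∧ ReflTransGen r u v := by
  have hmono : ∀ j, S j ⊆ S (j + 1) := by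
    intro j
    induction j with
    | zero => simp [h0]
    | succ j ih =>
      intro v hv
      rw [hs] at hv ⊢
      exact hv.imp_right fun ⟨u, hu, h⟩ => ⟨u, ih hu, h⟩
  have hstab : ∀ j, j ≤ (S j).card ∨ S (j + 1) = S j := by
    intro j
    induction j with
    | zero => simp
    | succ j ih =>
      by_cases h : S (j + 1) = S j
      · right
        ext v
        rw [hs, hs, h]
      · left
        have := Finset.card_lt_card ((hmono j).ssubset_of_ne (Ne.symm h))
        have := ih.resolve_right h
        omega
  have hfix : S (N + 1) = S N := by
    rcases hstab N with h | h
    · have : S N = Finset.univ := by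
        rw [← Finset.card_eq_iff_eq_univ]
        exact le_antisymm (Finset.card_le_univ _) (hN.trans h)
      rw [Finset.eq_univ_iff_forall] at this
      ext v
      exact ⟨fun _ => this v, fun h => hmono N h⟩
    · exact h
  constructor
  · have : ∀ j, ∀ v ∈ S j, ∃ u, Init u ∧ ReflTransGen r u v := by
      intro j
      induction j with
      | zero => simp [h0]
      | succ j ih =>
        intro v hv
        rcases (hs j v).mp hv with h | ⟨u, hu, h⟩
        · exact ⟨v, h, .refl⟩
        · obtain ⟨u', hu', h'⟩ := ih u hu
          exact ⟨u', hu', h'.tail h⟩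
    exact this N v
  · rintro ⟨u, hu, h⟩
    rw [← hfix]
    induction h with
    | refl => exact (hs N u).mpr (Or.inl hu)
    | tail _ hr ih => exact (hs N _).mpr (Or.inr ⟨_, hfix ▸ ih, hr⟩)

/-- Bind the array `b` to the states of the product that can be reached, over states that satisfy
`ok`, from the states that satisfy `init`. The state is given by the variables `2` and `3`. -/
def reachTerm (b : ℕ) (init ok rest : Term) : Term :=
  .iter b 2 3 (.and (lt (.var 2) (.inp (.const 1))) (.and (lt (.var 3) (.inp (.const 2)))
    (.or init (.sum 10 (.sum 11 (.sum 12 (.and (.get b (.var 10) (.var 11))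
      (.and (lt (.var 12) (.inp (.const 0)))
      (.and (eq (.get 1 (.var 10) (.var 12)) (.var 2))
      (.and (eq (.get 2 (.var 11) (.var 12)) (.var 3)) ok)))))))))) rest

/-- The product of the automaton and the don't care automaton. -/
def Instance.prod (I : Instance) : TransSystem (Fin I.k) (Fin I.n × Fin I.d) :=
  I.M.toTS.prod I.DC.toTS

section

variable {I : Instance} {L : ℕ} {w ρ : ℕ → ℕ} {σ : ℕ → ℕ → ℕ → ℕ}

/-- The hypotheses on `init` and `ok` range over all contents `A` of the array `b`, and that on `ok`
also over the variables 10 to 12: these terms must not depend on the iteration in progress. -/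
theorem eval_reachTerm (hin : Encodes I L w)
    (h1 : ∀ (q : Fin I.n) (a : Fin I.k), σ 1 q a = I.M.toTS.step q a)
    (h2 : ∀ (e : Fin I.d) (a : Fin I.k), σ 2 e a = I.DC.toTS.step e a) {b : ℕ} (hb1 : 1 ≠ b)
    (hb2 : 2 ≠ b) {init ok rest : Term} {Init Ok : Fin I.n × Fin I.d → Prop}
    (hinit : ∀ (v : Fin I.n × Fin I.d) A, init.Holds L w
      (Function.update (Function.update ρ 2 v.1) 3 v.2) (Function.update σ b A) ↔ Init v)
    (hok : ∀ (v : Fin I.n × Fin I.d) A x y a, ok.Holds L w (Function.update (Function.update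
      (Function.update (Function.update (Function.update ρ 2 v.1) 3 v.2) 10 x) 11 y) 12 a)
      (Function.update σ b A) ↔ Ok v) :
    ∃ A : ℕ → ℕ → ℕ, (reachTerm b init ok rest).eval L w ρ σ =
        rest.eval L w ρ (Function.update σ b A) ∧
      ∀ v : Fin I.n × Fin I.d,
        A v.1 v.2 ≠ 0 ↔ ∃ u, Init u ∧ ReflTransGen (I.prod.Edge Ok) u v := by
  have hn := hin.n_lt
  have hd := hin.d_lt
  have hk := hin.k_lt
  refine ⟨_, rfl, ?_⟩
  generalize hG : (fun (A : ℕ → ℕ → ℕ) (u v : ℕ) => Term.eval L w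
    ((lt (.var 2) (.inp (.const 1))).and ((lt (.var 3) (.inp (.const 2))).and
      (.or init (.sum 10 (.sum 11 (.sum 12 (.and (.get b (.var 10) (.var 11))
      (.and (lt (.var 12) (.inp (.const 0)))
      (.and (eq (.get 1 (.var 10) (.var 12)) (.var 2))
      (.and (eq (.get 2 (.var 11) (.var 12)) (.var 3)) ok))))))))))
    (Function.update (Function.update ρ 2 u) 3 v) (Function.update σ b A)) = G
  have hG1 : ∀ A x y, G A x y ≠ 0 → x < I.n ∧ y < I.d := by
    intro A x y h
    rw [← hG] at h
    have h' := (holds_and _ _).mp h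
    rw [holds_and] at h'
    simpa [Term.eval, hin.n, hin.d] using And.intro h'.1 h'.2.1
  have hG2 : ∀ A : ℕ → ℕ → ℕ, (∀ x y, A x y ≠ 0 → x < I.n ∧ y < I.d) →
      ∀ v : Fin I.n × Fin I.d, G A v.1 v.2 ≠ 0 ↔
        Init v ∨ ∃ u : Fin I.n × Fin I.d, A u.1 u.2 ≠ 0 ∧ I.prod.Edge Ok u v := by
    intro A hA v
    rw [← hG]
    change Term.Holds _ _ _ _ _ ↔ _
    simp only [holds_and, holds_or, holds_sum, hinit, hok, holds_lt, holds_eq, Term.eval, hin.n,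
      hin.d, hin.k, Function.update_apply]
    simp only [Holds, Term.eval, Function.update_apply]
    simp only [hb1, hb2, Nat.reduceEqDiff, if_true, if_false, v.1.2, v.2.2,
      true_and]
    refine or_congr Iff.rfl ⟨?_, ?_⟩
    · rintro ⟨x, hx, y, hy, a, ha, hAxy, hak, e1, e2, ho⟩
      rw [if_pos ⟨hx, hy⟩] at hAxy
      rw [if_pos ⟨hx, ha⟩] at e1
      rw [if_pos ⟨hy, ha⟩] at e2
      obtain ⟨hxn, hyd⟩ := hA x y hAxy
      refine ⟨(⟨x, hxn⟩, ⟨y, hyd⟩), hAxy, ⟨a, hak⟩, ?_, ho⟩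
      rw [h1 ⟨x, hxn⟩ ⟨a, hak⟩] at e1
      rw [h2 ⟨y, hyd⟩ ⟨a, hak⟩] at e2
      exact Prod.ext (Fin.ext e1) (Fin.ext e2)
    · rintro ⟨u, hu, a, rfl, ho⟩
      have l1 : (u.1 : ℕ) < L := u.1.2.trans hn
      have l2 : (u.2 : ℕ) < L := u.2.2.trans hd
      have l3 : (a : ℕ) < L := a.2.trans hk
      refine ⟨u.1, l1, u.2, l2, a, l3, ?_, a.2, ?_, ?_, ho⟩
      · rwa [if_pos ⟨l1, l2⟩]
      · rw [if_pos ⟨l1, l3⟩, h1]; rfl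
      · rw [if_pos ⟨l2, l3⟩, h2]; rfl
  -- Cells outside the product stay zero, so a nonzero cell found by the sums, which run up to `L`,
  -- always names a state of the product.
  have hbd : ∀ j x y, G^[j] (fun _ _ => 0) x y ≠ 0 → x < I.n ∧ y < I.d := by
    intro j x y h
    cases j with
    | zero => exact absurd rfl h
    | succ j =>
      rw [Function.iterate_succ_apply'] at h
      exact hG1 _ x y h
  classical
  intro v
  have := mem_iterate_iff_reachable (Init := Init) (r := I.prod.Edge Ok)
    (S := fun j => Finset.univ.filter fun v : Fin I.n × Fin I.d => G^[j] (fun _ _ => 0) v.1 v.2 ≠ 0)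
    (by simp) (fun j v => by
      simp only [Finset.mem_filter, Finset.mem_univ, true_and]
      rw [Function.iterate_succ_apply', hG2 _ (hbd j)]) (N := L * L)
    (by simpa using Nat.mul_le_mul hn.le hd.le) v
  simpa using this

end

end DontCare

/-! ### The conflict test and the greedy rounds as terms -/

namespace DontCare

open RAM RAM.Term Relation

/-- The arrays `1` to `5` hold the tables of the instance. -/
structure Tables (I : Instance) (σ : ℕ → ℕ → ℕ → ℕ) : Prop where
  stepM : ∀ (q : Fin I.n) (a : Fin I.k), σ 1 q a = I.M.toTS.step q a
  stepD : ∀ (e : Fin I.d) (a : Fin I.k), σ 2 e a = I.DC.toTS.step e a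
  prioM : ∀ q : Fin I.n, σ 3 q 0 = I.M.prio q
  prioD : ∀ e : Fin I.d, σ 4 e 0 = I.DC.prio e
  h : ∀ q : Fin I.n, σ 5 q 0 = I.h q

/-- The state given by the variables `2` and `3` satisfies `LoopOk` for the states `6` and `8`. -/
def okTerm : Term :=
  .and (.not (.get 7 (.get 5 (.var 2) (.const 0)) (.var 5)))
    (.and (.le (.get 3 (.var 2) (.const 0)) (.get 3 (.var 6) (.const 0)))
      (.le (.get 4 (.var 3) (.const 0)) (.get 4 (.var 8) (.const 0))))

/-- There is a loop that starts in the state `(6, 7)` with the letter `9` and visits `8` and a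
state over `4`. -/
def loopTerm : Term :=
  reachTerm 8 (.and (eq (.var 2) (.get 1 (.var 6) (.var 9)))
      (.and (eq (.var 3) (.get 2 (.var 7) (.var 9))) okTerm)) okTerm
    (reachTerm 9 (.and (.get 8 (.var 2) (.var 3)) (eq (.var 3) (.var 8))) okTerm
      (reachTerm 10 (.and (.get 9 (.var 2) (.var 3)) (eq (.get 5 (.var 2) (.const 0)) (.var 4)))
        okTerm (.get 10 (.var 6) (.var 7))))

/-- The priority of the current round. -/
def roundTerm : Term := .minus (.plus (.var 0) (.var 5)) (.plus (.const 2) (.get 7 (.var 4) (.const 2)))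

/-- The state `4` has a conflict in the current round of the assignment `5`. -/
def conflictTerm : Term :=
  .sum 6 (.sum 7 (.sum 8 (.sum 9 (.and (lt (.var 6) (.inp (.const 1)))
    (.and (lt (.var 7) (.inp (.const 2))) (.and (lt (.var 8) (.inp (.const 2)))
    (.and (lt (.var 9) (.inp (.const 0))) (.and (odd (.get 4 (.var 8) (.const 0)))
    (.and (odd (.plus (.get 3 (.var 6) (.const 0)) roundTerm))
    (.and (.get 6 (.var 6) (.var 7)) loopTerm))))))))))

/-- Bind the array `7` to the greedy assignments, in the columns `0` and `1`; the column `2`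
counts the rounds. -/
def greedyTerm (rest : Term) : Term :=
  .iter 7 4 5 (.cond (eq (.var 5) (.const 2)) (.plus (.get 7 (.var 4) (.const 2)) (.const 1))
    (.cond (.get 7 (.var 4) (.var 5)) (.get 7 (.var 4) (.var 5))
      (.cond conflictTerm (.const 0) roundTerm))) rest

section

variable {I : Instance} {L : ℕ} {w ρ : ℕ → ℕ} {σ : ℕ → ℕ → ℕ → ℕ}

theorem Tables.update (h : Tables I σ) {b : ℕ} (hb : 5 < b) (A : ℕ → ℕ → ℕ) :
    Tables I (Function.update σ b A) := by
  have h1 : 1 ≠ b := by omega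
  have h2 : 2 ≠ b := by omega
  have h3 : 3 ≠ b := by omega
  have h4 : 4 ≠ b := by omega
  have h5 : 5 ≠ b := by omega
  constructor
  · simpa [Function.update_of_ne h1] using h.stepM
  · simpa [Function.update_of_ne h2] using h.stepD
  · simpa [Function.update_of_ne h3] using h.prioM
  · simpa [Function.update_of_ne h4] using h.prioD
  · simpa [Function.update_of_ne h5] using h.h

theorem eval_get (a : ℕ) {e f : Term} {x y : ℕ} (he : e.eval L w ρ σ = x) (hf : f.eval L w ρ σ = y)
    (hx : x < L) (hy : y < L) : (Term.get a e f).eval L w ρ σ = σ a x y := by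
  rw [Term.eval, he, hf, if_pos ⟨hx, hy⟩]

theorem eval_get_var (a : ℕ) {i j x y : ℕ} (hi : ρ i = x) (hj : ρ j = y) (hx : x < L)
    (hy : y < L) : (Term.get a (.var i) (.var j)).eval L w ρ σ = σ a x y :=
  eval_get a hi hj hx hy

theorem eval_get_const (a : ℕ) {i x y : ℕ} (hi : ρ i = x) (hx : x < L) (hy : y < L) :
    (Term.get a (.var i) (.const y)).eval L w ρ σ = σ a x y :=
  eval_get a hi rfl hx hy

theorem holds_okTerm (hin : Encodes I L w) (ht : Tables I σ) {i : ℕ} {S : Set (Fin I.n')}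
    {q : Fin I.n} {e : Fin I.d} {v : Fin I.n × Fin I.d} (hi : i < 2)
    (hS : ∀ p : Fin I.n', σ 7 p i = 0 ↔ p ∈ S) (h2 : ρ 2 = v.1) (h3 : ρ 3 = v.2) (h5 : ρ 5 = i)
    (h6 : ρ 6 = q) (h8 : ρ 8 = e) :
    okTerm.Holds L w ρ σ ↔ LoopOk I.M I.DC I.h S q e v := by
  have hn := hin.n_lt
  have hd := hin.d_lt
  have hn' := hin.n'_lt
  have g1 : (Term.get 5 (.var 2) (.const 0)).eval L w ρ σ = I.h v.1 :=
    (eval_get_const 5 h2 (v.1.2.trans hn) (by omega)).trans (ht.h _)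
  have g2 : (Term.get 7 (.get 5 (.var 2) (.const 0)) (.var 5)).eval L w ρ σ = σ 7 (I.h v.1) i :=
    eval_get 7 g1 h5 (by have := (I.h v.1).2; omega) (by omega)
  have g3 : (Term.get 3 (.var 2) (.const 0)).eval L w ρ σ = I.M.prio v.1 :=
    (eval_get_const 3 h2 (v.1.2.trans hn) (by omega)).trans (ht.prioM _)
  have g4 : (Term.get 3 (.var 6) (.const 0)).eval L w ρ σ = I.M.prio q :=
    (eval_get_const 3 h6 (q.2.trans hn) (by omega)).trans (ht.prioM _)
  have g5 : (Term.get 4 (.var 3) (.const 0)).eval L w ρ σ = I.DC.prio v.2 :=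
    (eval_get_const 4 h3 (v.2.2.trans hd) (by omega)).trans (ht.prioD _)
  have g6 : (Term.get 4 (.var 8) (.const 0)).eval L w ρ σ = I.DC.prio e :=
    (eval_get_const 4 h8 (e.2.trans hd) (by omega)).trans (ht.prioD _)
  simp only [okTerm, holds_and, holds_not, holds_le, g3, g4, g5, g6]
  rw [Holds, g2, not_not, hS, LoopOk]

/-- Three nested reachability computations, one per path of `conflict_iff`: each is seeded with
those states of the previous one that have second component `e₁`, respectively lie over `p`. -/
theorem holds_loopTerm (hin : Encodes I L w) (ht : Tables I σ) {i : ℕ} {S : Set (Fin I.n')}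
    {q : Fin I.n} {e e₁ : Fin I.d} {a : Fin I.k} {p : Fin I.n'} (hi : i < 2)
    (hS : ∀ p : Fin I.n', σ 7 p i = 0 ↔ p ∈ S) (h4 : ρ 4 = p) (h5 : ρ 5 = i)
    (h6 : ρ 6 = q) (h7 : ρ 7 = e) (h8 : ρ 8 = e₁) (h9 : ρ 9 = a) :
    loopTerm.Holds L w ρ σ ↔ LoopOk I.M I.DC I.h S q e₁ (I.prod.step (q, e) a) ∧
      ∃ u₁ u₂ : Fin I.n × Fin I.d,
        ReflTransGen (I.prod.Edge (LoopOk I.M I.DC I.h S q e₁)) (I.prod.step (q, e) a) u₁ ∧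
        u₁.2 = e₁ ∧ ReflTransGen (I.prod.Edge (LoopOk I.M I.DC I.h S q e₁)) u₁ u₂ ∧
        I.h u₂.1 = p ∧ ReflTransGen (I.prod.Edge (LoopOk I.M I.DC I.h S q e₁)) u₂ (q, e) := by
  have hn := hin.n_lt
  have hd := hin.d_lt
  have hk := hin.k_lt
  have hok : ∀ (σ' : ℕ → ℕ → ℕ → ℕ) (b : ℕ), 7 < b → Tables I σ' → σ' 7 = σ 7 →
      ∀ (v : Fin I.n × Fin I.d) A x y a, okTerm.Holds L w (Function.update (Function.update
      (Function.update (Function.update (Function.update ρ 2 v.1) 3 v.2) 10 x) 11 y) 12 a)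
      (Function.update σ' b A) ↔ LoopOk I.M I.DC I.h S q e₁ v := by
    intro σ' b hb ht' h7' v A x y a
    have hb' : 7 ≠ b := by omega
    refine holds_okTerm hin (ht'.update (by omega) A) hi (fun p => ?_) ?_ ?_ ?_ ?_ ?_
    · rw [Function.update_of_ne hb', h7', hS]
    all_goals simp [h5, h6, h8]
  obtain ⟨A0, e0, hA0⟩ := eval_reachTerm (ρ := ρ) (b := 8)
    (init := .and (eq (.var 2) (.get 1 (.var 6) (.var 9)))
      (.and (eq (.var 3) (.get 2 (.var 7) (.var 9))) okTerm)) (ok := okTerm)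
    (Init := fun v => v = I.prod.step (q, e) a ∧ LoopOk I.M I.DC I.h S q e₁ v)
    (rest := reachTerm 9 (.and (.get 8 (.var 2) (.var 3)) (eq (.var 3) (.var 8))) okTerm
      (reachTerm 10 (.and (.get 9 (.var 2) (.var 3)) (eq (.get 5 (.var 2) (.const 0)) (.var 4)))
        okTerm (.get 10 (.var 6) (.var 7)))) hin ht.stepM ht.stepD (by omega) (by omega)
    (fun v A => by
      have ht' := ht.update (b := 8) (by omega) A
      have o := holds_okTerm hin ht' (ρ := Function.update (Function.update ρ 2 v.1) 3 v.2) (v := v)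
        (q := q) (e := e₁) hi (S := S) (by simpa using hS) (by simp) (by simp) (by simpa using h5)
        (by simpa using h6) (by simpa using h8)
      rw [holds_and, holds_and, o, holds_eq, holds_eq, eval_get (x := q) (y := a),
        eval_get (x := e) (y := a), ht'.stepM, ht'.stepD, ← and_assoc]
      · refine and_congr_left' ?_
        simp [Term.eval, Instance.prod, TransSystem.prod, Prod.ext_iff,
          Fin.ext_iff]
      · simpa [Term.eval] using h7
      · simpa [Term.eval] using h9
      · exact e.2.trans hd
      · exact a.2.trans hk
      · simpa [Term.eval] using h6
      · simpa [Term.eval] using h9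
      · exact q.2.trans hn
      · exact a.2.trans hk) (hok σ 8 (by omega) ht rfl)
  have ht1 := ht.update (b := 8) (by omega) A0
  obtain ⟨A1, e1, hA1⟩ := eval_reachTerm (ρ := ρ) (b := 9)
    (init := .and (.get 8 (.var 2) (.var 3)) (eq (.var 3) (.var 8))) (ok := okTerm)
    (Init := fun v => A0 v.1 v.2 ≠ 0 ∧ v.2 = e₁)
    (rest := reachTerm 10 (.and (.get 9 (.var 2) (.var 3)) (eq (.get 5 (.var 2) (.const 0)) (.var 4)))
        okTerm (.get 10 (.var 6) (.var 7))) hin ht1.stepM ht1.stepD (by omega) (by omega)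
    (fun v A => by
      rw [holds_and, Holds, eval_get (x := v.1) (y := v.2) 8 (by simp [Term.eval])
        (by simp [Term.eval]) (v.1.2.trans hn) (v.2.2.trans hd)]
      simp [Term.eval, h8, Fin.ext_iff])
    (hok _ 9 (by omega) ht1 (by simp))
  have ht2 := ht1.update (b := 9) (by omega) A1
  obtain ⟨A2, e2, hA2⟩ := eval_reachTerm (ρ := ρ) (b := 10)
    (init := .and (.get 9 (.var 2) (.var 3)) (eq (.get 5 (.var 2) (.const 0)) (.var 4)))
    (ok := okTerm) (Init := fun v => A1 v.1 v.2 ≠ 0 ∧ I.h v.1 = p)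
    (rest := .get 10 (.var 6) (.var 7)) hin ht2.stepM ht2.stepD (by omega) (by omega)
    (fun v A => by
      rw [holds_and, Holds, eval_get (x := v.1) (y := v.2) 9 (by simp [Term.eval])
        (by simp [Term.eval]) (v.1.2.trans hn) (v.2.2.trans hd), holds_eq,
        eval_get (x := v.1) (y := 0) 5 (by simp [Term.eval]) rfl (v.1.2.trans hn) (by omega),
        (ht2.update (b := 10) (by omega) A).h]
      simp [Term.eval, h4, Fin.ext_iff])
    (hok _ 10 (by omega) ht2 (by simp))
  rw [Holds, loopTerm, e0, e1, e2, eval_get_var 10 h6 h7 (q.2.trans hn)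
    (e.2.trans hd), Function.update_self, hA2 (q, e)]
  simp only [hA1, hA0]
  constructor
  · rintro ⟨u₂, ⟨⟨u₁, ⟨⟨u₀, ⟨rfl, ho⟩, r1⟩, hu1⟩, r2⟩, hu2⟩, r3⟩
    exact ⟨ho, u₁, u₂, r1, hu1, r2, hu2, r3⟩
  · rintro ⟨ho, u₁, u₂, r1, hu1, r2, hu2, r3⟩
    exact ⟨u₂, ⟨⟨u₁, ⟨⟨_, ⟨rfl, ho⟩, r1⟩, hu1⟩, r2⟩, hu2⟩, r3⟩

theorem holds_conflictTerm (hin : Encodes I L w) (ht : Tables I σ)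
    (hreach : ∀ v : Fin I.n × Fin I.d,
      σ 6 v.1 v.2 ≠ 0 ↔ ReflTransGen (I.prod.Edge fun _ => True) I.prod.init v)
    {i c : ℕ} {S : Set (Fin I.n')} {p : Fin I.n'} (hi : i < 2)
    (hS : ∀ p : Fin I.n', σ 7 p i = 0 ↔ p ∈ S) (h0 : ρ 0 = L) (h4 : ρ 4 = p) (h5 : ρ 5 = i)
    (hc : L + i - (2 + σ 7 p 2) = c) :
    conflictTerm.Holds L w ρ σ ↔ Conflict I.M I.DC I.T' S p c := by
  have hn := hin.n_lt
  have hd := hin.d_lt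
  have hk := hin.k_lt
  have hn' := hin.n'_lt
  rw [conflict_iff I.hom]
  have key : ∀ (q : Fin I.n) (e e₁ : Fin I.d) (a : Fin I.k) (ρ' : ℕ → ℕ), ρ' 0 = L → ρ' 4 = p →
      ρ' 5 = i → ρ' 6 = q → ρ' 7 = e → ρ' 8 = e₁ → ρ' 9 = a →
      (((odd (.get 4 (.var 8) (.const 0))).Holds L w ρ' σ ∧
        (odd (.plus (.get 3 (.var 6) (.const 0)) roundTerm)).Holds L w ρ' σ ∧
        (Term.get 6 (.var 6) (.var 7)).Holds L w ρ' σ ∧ loopTerm.Holds L w ρ' σ) ↔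
      ¬ Even (I.DC.prio e₁) ∧ ¬ (Even (I.M.prio q) ↔ Even c) ∧
      ReflTransGen (I.prod.Edge fun _ => True) I.prod.init (q, e) ∧
      LoopOk I.M I.DC I.h S q e₁ (I.prod.step (q, e) a) ∧
      ∃ u₁ u₂ : Fin I.n × Fin I.d,
        ReflTransGen (I.prod.Edge (LoopOk I.M I.DC I.h S q e₁)) (I.prod.step (q, e) a) u₁ ∧
        u₁.2 = e₁ ∧ ReflTransGen (I.prod.Edge (LoopOk I.M I.DC I.h S q e₁)) u₁ u₂ ∧
        I.h u₂.1 = p ∧ ReflTransGen (I.prod.Edge (LoopOk I.M I.DC I.h S q e₁)) u₂ (q, e)) := by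
    intro q e e₁ a ρ' h0 h4 h5 h6 h7 h8 h9
    rw [holds_loopTerm hin ht hi hS h4 h5 h6 h7 h8 h9, holds_odd, holds_odd, Holds,
      eval_get_const 4 h8 (e₁.2.trans hd) (by omega), ht.prioD,
      eval_get_var 6 h6 h7 (q.2.trans hn) (e.2.trans hd), ← hreach (q, e)]
    have hr : roundTerm.eval L w ρ' σ = c := by
      have hg := eval_get_const (L := L) (w := w) (ρ := ρ') (σ := σ) 7 (y := 2) h4
        (by have := p.2; omega) (by omega)
      simp only [roundTerm, Term.eval] at hg ⊢
      rw [hg, h0, h5, hc]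
    have hq : (Term.get 3 (.var 6) (.const 0)).eval L w ρ' σ = I.M.prio q :=
      (eval_get_const 3 h6 (q.2.trans hn) (by omega)).trans (ht.prioM q)
    -- Two numbers differ in parity exactly when their sum is odd.
    rw [Term.eval, hr, hq, Nat.even_add]
  simp only [conflictTerm, holds_sum, holds_and, holds_lt]
  constructor
  · rintro ⟨q, -, e, -, e₁, -, a, -, hq, he, he₁, ha, hrest⟩
    simp [Term.eval, hin.n, hin.d, hin.k] at hq he he₁ ha
    exact ⟨⟨q, hq⟩, ⟨e, he⟩, ⟨e₁, he₁⟩, ⟨a, ha⟩, (key ⟨q, hq⟩ ⟨e, he⟩ ⟨e₁, he₁⟩ ⟨a, ha⟩ _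
      (by simpa using h0) (by simpa using h4) (by simpa using h5) (by simp) (by simp) (by simp)
      (by simp)).mp hrest⟩
  · rintro ⟨q, e, e₁, a, h⟩
    refine ⟨q, q.2.trans hn, e, e.2.trans hd, e₁, e₁.2.trans hd, a, a.2.trans hk, ?_, ?_, ?_, ?_,
      (key q e e₁ a _ (by simpa using h0) (by simpa using h4) (by simpa using h5) (by simp) (by simp)
        (by simp) (by simp)).mpr h⟩
    all_goals simp [Term.eval, hin.n, hin.d, hin.k]

/-- The columns 0 and 1 carry the runs with first numbers `L - 2` and `L - 1`. Each reads only
itself and the round counter in column 2, so both runs proceed in the same iteration and the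
contents of the other columns do not matter. -/
theorem eval_greedyTerm (hin : Encodes I L w) (ht : Tables I σ)
    (hreach : ∀ v : Fin I.n × Fin I.d,
      σ 6 v.1 v.2 ≠ 0 ↔ ReflTransGen (I.prod.Edge fun _ => True) I.prod.init v)
    (h0 : ρ 0 = L) (rest : Term) :
    ∃ A : ℕ → ℕ → ℕ, (greedyTerm rest).eval L w ρ σ = rest.eval L w ρ (Function.update σ 7 A) ∧
      ∀ p : Fin I.n', ∀ i < 2, A p i = I.greedyPrio (L - 2 + i) (L * L) p := by
  have hn' := hin.n'_lt
  refine ⟨_, rfl, ?_⟩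
  generalize hG : (fun (A : ℕ → ℕ → ℕ) (u v : ℕ) => Term.eval L w
    (.cond (eq (.var 5) (.const 2)) (.plus (.get 7 (.var 4) (.const 2)) (.const 1))
      (.cond (.get 7 (.var 4) (.var 5)) (.get 7 (.var 4) (.var 5))
        (.cond conflictTerm (.const 0) roundTerm)))
    (Function.update (Function.update ρ 4 u) 5 v) (Function.update σ 7 A)) = G
  have key : ∀ j, ∀ p : Fin I.n', G^[j] (fun _ _ => 0) p 2 = j ∧
      ∀ i < 2, G^[j] (fun _ _ => 0) p i = I.greedyPrio (L - 2 + i) j p := by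
    intro j
    induction j with
    | zero => intro p; exact ⟨rfl, fun i _ => rfl⟩
    | succ j ih =>
      classical
      intro p
      have hp : (p : ℕ) < L := by have := p.2; omega
      rw [Function.iterate_succ_apply']
      set A := G^[j] (fun _ _ => 0) with hA
      have e2 : ∀ i, (Term.get 7 (.var 4) (.const 2)).eval L w
          (Function.update (Function.update ρ 4 p) 5 i) (Function.update σ 7 A) = j := fun i => by
        rw [eval_get 7 (x := p) (y := 2) (by simp [Term.eval]) rfl hp (by omega)]
        simpa using (ih p).1
      constructor
      · rw [← hG]
        dsimp only
        rw [eval_cond, if_pos (by simp [Term.eval]), Term.eval, e2]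
        rfl
      · intro i hi
        rw [← hG]
        dsimp only
        have ei : (Term.get 7 (.var 4) (.var 5)).eval L w
            (Function.update (Function.update ρ 4 p) 5 i) (Function.update σ 7 A) =
            I.greedyPrio (L - 2 + i) j p := by
          rw [eval_get 7 (x := p) (y := i) (by simp [Term.eval]) (by simp [Term.eval]) hp (by omega)]
          simpa using (ih p).2 i hi
        have er : roundTerm.eval L w (Function.update (Function.update ρ 4 p) 5 i)
            (Function.update σ 7 A) = L - 2 + i - j := by
          have e2' := e2 i
          simp only [roundTerm, Term.eval] at e2' ⊢
          rw [e2']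
          simp [h0]
          omega
        have hc := holds_conflictTerm (ρ := Function.update (Function.update ρ 4 p) 5 i) hin
          (ht.update (b := 7) (by omega) A) (by simpa using hreach) (c := L - 2 + i - j)
          (S := {p' | I.greedyPrio (L - 2 + i) j p' = 0}) (p := p) hi
          (fun p' => by simp [(ih p').2 i hi]) (by simpa using h0) (by simp) (by simp)
          (by simp [(ih p).1]; omega)
        rw [eval_cond, if_neg (by simp [Term.eval]; omega), eval_cond, eval_cond, er, ei]
        simp only [hc]
        rw [Holds, ei]
        simp only [Instance.greedyPrio, greedy, Term.eval]
        congr 1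
  exact fun p => (key (L * L) p).2

end

end DontCare

/-! ### Reading the input tables and selecting the answer -/

namespace DontCare

open RAM RAM.Term Relation

/-- The place in the input after the tables of the automaton. -/
def afterM : Term :=
  .plus (.plus (.const 5) (mulHead (.inp (.const 1)))) (.inp (.const 1))

/-- The place of the priorities of the don't care automaton. -/
def placePrioD : Term :=
  .plus (.plus (.const 1) afterM) (mulHead (.inp (.const 2)))

/-- The place of the table of the homomorphism. -/
def placeHom : Term :=
  .plus (.plus (.plus (.const 1) placePrioD) (.inp (.const 2))) (mulHead (.inp (.const 3)))

/-- Bind the arrays `1` to `5` to the tables of the instance. -/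
def tablesTerm (rest : Term) : Term :=
  letArr 1 (.inp (.plus (.plus (.const 5) (mulHead (.var 2))) (.var 3)))
    (letArr 2 (.inp (.plus (.plus (.plus (.const 1) afterM) (mulHead (.var 2))) (.var 3)))
      (letArr 3 (.inp (.plus (.plus (.const 5) (mulHead (.inp (.const 1)))) (.var 2)))
        (letArr 4 (.inp (.plus placePrioD (.var 2)))
          (letArr 5 (.inp (.plus placeHom (.var 2))) rest))))

/-- Bind the array `7` to the greedy assignments. -/
def contextTerm (rest : Term) : Term :=
  tablesTerm (reachTerm 6 (.and (eq (.var 2) (.inp (.const 4))) (eq (.var 3) (.inp afterM)))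
    (.const 1) (greedyTerm rest))

/-- The assignment in column `i` is total. -/
def totalTerm (i : ℕ) : Term :=
  .not (.sum 15 (.and (lt (.var 15) (.inp (.const 3))) (.not (.get 7 (.var 15) (.const i)))))

/-- The number of priorities of the assignment in column `i`. -/
def countTerm (i : ℕ) : Term :=
  .sum 14 (.cond (.sum 15 (.and (lt (.var 15) (.inp (.const 3)))
    (eq (.get 7 (.var 15) (.const i)) (.var 14)))) (.const 1) (.const 0))

/-- The second assignment is to be taken. -/
def secondTerm : Term :=
  .or (.not (totalTerm 0)) (.and (totalTerm 1) (lt (countTerm 1) (countTerm 0)))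

/-- The entry of the output with index `1`. -/
def entryTerm : Term :=
  .cond (.var 1)
    (.cond secondTerm (.get 7 (.minus (.var 1) (.const 1)) (.const 1))
      (.get 7 (.minus (.var 1) (.const 1)) (.const 0)))
    (.cond (.or (totalTerm 0) (totalTerm 1)) (.const 1) (.const 0))

/-- The length of the output. -/
def lengthTerm : Term :=
  .cond (.or (totalTerm 0) (totalTerm 1)) (.plus (.inp (.const 3)) (.const 1)) (.const 1)

section

variable {I : Instance} {L : ℕ} {w ρ : ℕ → ℕ} {σ : ℕ → ℕ → ℕ → ℕ}

theorem eval_var (x : ℕ) : (Term.var x).eval L w ρ σ = ρ x := rfl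

theorem eval_inp_const (x : ℕ) : (Term.inp (.const x)).eval L w ρ σ = w x := rfl

theorem eval_mulHead_inp (hin : Encodes I L w) {c v : ℕ} (hc : w c = v) (hv : v ≤ L) :
    (mulHead (.inp (.const c))).eval L w ρ σ = v * I.k := by
  rw [eval_mulHead (fun _ => rfl) (by simpa [Term.eval, hc] using hv)]
  simp [Term.eval, hc, hin.k]

theorem eval_mulHead_var (hin : Encodes I L w) {v : ℕ} (hv : v ≤ L) (hρ : ρ 2 = v) :
    (mulHead (.var 2)).eval L w ρ σ = v * I.k := by
  rw [eval_mulHead (fun _ => rfl) (by simpa [Term.eval, hρ] using hv)]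
  simp [Term.eval, hρ, hin.k]

theorem eval_afterM (hin : Encodes I L w) :
    afterM.eval L w ρ σ = 5 + I.n * I.k + I.n := by
  simp only [afterM, Term.eval, eval_mulHead_inp hin hin.n hin.n_lt.le, hin.n]

theorem eval_placePrioD (hin : Encodes I L w) :
    placePrioD.eval L w ρ σ = 6 + I.n * I.k + I.n + I.d * I.k := by
  simp only [placePrioD, Term.eval, eval_mulHead_inp hin hin.d hin.d_lt.le, eval_afterM hin]
  omega

theorem eval_placeHom (hin : Encodes I L w) :
    placeHom.eval L w ρ σ = 7 + I.n * I.k + I.n + I.d * I.k + I.d + I.n' * I.k := by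
  have := hin.n'_lt
  simp only [placeHom, Term.eval, eval_mulHead_inp hin hin.n' (by omega), eval_placePrioD hin,
    hin.d]
  omega

theorem eval_tablesTerm (hin : Encodes I L w) (rest : Term) :
    ∃ σ', Tables I σ' ∧ (tablesTerm rest).eval L w ρ σ = rest.eval L w ρ σ' := by
  have hn := hin.n_lt
  have hd := hin.d_lt
  have hL : 0 < L := by omega
  rw [tablesTerm, eval_letArr hL fun _ _ _ => rfl, eval_letArr hL fun _ _ _ => rfl,
    eval_letArr hL fun _ _ _ => rfl, eval_letArr hL fun _ _ _ => rfl,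
    eval_letArr hL fun _ _ _ => rfl]
  refine ⟨_, ⟨?_, ?_, ?_, ?_, ?_⟩, rfl⟩
  · intro q a
    have m : ∀ τ, (mulHead (.var 2)).eval L w (Function.update (Function.update ρ 2 q) 3 a) τ =
        q * I.k := fun τ => eval_mulHead_var hin (q.2.trans hn).le (by simp)
    simp only [Function.update_apply, Nat.reduceEqDiff, if_true, if_false]
    simp only [← hin.stepM, Term.eval, m, Function.update_self]
  · intro e a
    have m : ∀ τ, (mulHead (.var 2)).eval L w (Function.update (Function.update ρ 2 e) 3 a) τ =
        e * I.k := fun τ => eval_mulHead_var hin (e.2.trans hd).le (by simp)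
    simp only [Function.update_apply, Nat.reduceEqDiff, if_true, if_false]
    simp only [← hin.stepD, Term.eval, m, Function.update_self, eval_afterM hin]
    congr 1
    omega
  · intro q
    simp only [Function.update_apply, Nat.reduceEqDiff, if_true, if_false]
    simp [← hin.prioM, Term.eval, eval_mulHead_inp hin hin.n hn.le]
  · intro e
    simp only [Function.update_apply, Nat.reduceEqDiff, if_true, if_false]
    simp [← hin.prioD, Term.eval, eval_placePrioD hin]
  · intro q
    simp only [Function.update_apply, Nat.reduceEqDiff, if_true, if_false]
    simp [← hin.h, Term.eval, eval_placeHom hin]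

theorem eval_contextTerm (hin : Encodes I L w) (h0 : ρ 0 = L) (rest : Term) :
    ∃ σ' : ℕ → ℕ → ℕ → ℕ,
      (∀ p : Fin I.n', ∀ i < 2, σ' 7 p i = I.greedyPrio (L - 2 + i) (L * L) p) ∧
      (contextTerm rest).eval L w ρ σ = rest.eval L w ρ σ' := by
  obtain ⟨σ₁, ht, e1⟩ := eval_tablesTerm (ρ := ρ) (σ := σ) hin (reachTerm 6
    (.and (eq (.var 2) (.inp (.const 4))) (eq (.var 3) (.inp afterM))) (.const 1) (greedyTerm rest))
  obtain ⟨B, e2, hB⟩ := eval_reachTerm (ρ := ρ) (b := 6) hin ht.stepM ht.stepD (by omega) (by omega)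
    (init := .and (eq (.var 2) (.inp (.const 4))) (eq (.var 3) (.inp afterM))) (ok := .const 1)
    (Init := fun v => v = I.prod.init) (Ok := fun _ => True) (rest := greedyTerm rest)
    (fun v A => by
      simp only [holds_and, holds_eq, Term.eval, eval_afterM hin, hin.initM, hin.initD]
      simp [Instance.prod, TransSystem.prod, Prod.ext_iff, Fin.ext_iff])
    (fun v A x y a => by simp [Holds, Term.eval])
  obtain ⟨A, e3, hA⟩ := eval_greedyTerm (ρ := ρ) hin (ht.update (b := 6) (by omega) B)
    (fun v => by simpa using hB v) h0 rest
  refine ⟨Function.update (Function.update σ₁ 6 B) 7 A, fun p i hi => ?_,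
    by rw [contextTerm, e1, e2, e3]⟩
  rw [Function.update_self, hA p i hi]

variable {c : ℕ → Fin I.n' → ℕ}

theorem exists_lt_iff_fin (hin : Encodes I L w) {P : ℕ → Prop} :
    (∃ v < L, v < I.n' ∧ P v) ↔ ∃ p : Fin I.n', P p := by
  have := hin.n'_lt
  constructor
  · rintro ⟨v, -, hv, h⟩
    exact ⟨⟨v, hv⟩, h⟩
  · rintro ⟨p, h⟩
    exact ⟨p, by omega, p.2, h⟩

theorem eval_get_column (hin : Encodes I L w) (hσ : ∀ p : Fin I.n', ∀ i < 2, σ 7 p i = c i p)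
    {i x : ℕ} (hi : i < 2) {p : Fin I.n'} (hρ : ρ x = p) :
    (Term.get 7 (.var x) (.const i)).eval L w ρ σ = c i p := by
  have := hin.n'_lt
  rw [eval_get_const 7 hρ (by omega) (by omega), hσ p i hi]

theorem holds_totalTerm (hin : Encodes I L w) (hσ : ∀ p : Fin I.n', ∀ i < 2, σ 7 p i = c i p)
    {i : ℕ} (hi : i < 2) : (totalTerm i).Holds L w ρ σ ↔ ∀ p, c i p ≠ 0 := by
  simp only [totalTerm, holds_not, holds_sum, holds_and, holds_lt]
  simp only [eval_var, eval_inp_const, Function.update_self, hin.n', exists_lt_iff_fin hin]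
  push Not
  refine forall_congr' fun p => ?_
  rw [Holds, eval_get_column hin hσ hi (p := p) (by simp)]

/-- The term counts the `v < L` that are values of the assignment; `hlt` ensures that no value is
missed. -/
theorem eval_countTerm (hin : Encodes I L w) (hσ : ∀ p : Fin I.n', ∀ i < 2, σ 7 p i = c i p)
    {i : ℕ} (hi : i < 2) (hlt : ∀ p, c i p < L) :
    (countTerm i).eval L w ρ σ = numPriorities (c i) := by
  classical
  have h : ∀ v, (Term.sum 15 (.and (lt (.var 15) (.inp (.const 3)))
      (eq (.get 7 (.var 15) (.const i)) (.var 14)))).Holds L w (Function.update ρ 14 v) σ ↔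
      v ∈ Finset.univ.image (c i) := by
    intro v
    simp only [holds_sum, holds_and, holds_lt, holds_eq]
    simp only [eval_var, eval_inp_const, Function.update_self, hin.n', exists_lt_iff_fin hin,
      Finset.mem_image, Finset.mem_univ, true_and]
    refine exists_congr fun p => ?_
    rw [eval_get_column hin hσ hi (p := p) (by simp)]
    simp
  rw [countTerm, Term.eval]
  simp only [eval_cond, h]
  simp only [Term.eval]
  rw [Finset.sum_boole, numPriorities, Nat.cast_id]
  congr 1
  ext v
  simp only [Finset.mem_filter, Finset.mem_range, and_iff_right_iff_imp]
  intro hv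
  obtain ⟨p, -, rfl⟩ := Finset.mem_image.mp hv
  exact hlt p

theorem holds_secondTerm (hin : Encodes I L w) (hσ : ∀ p : Fin I.n', ∀ i < 2, σ 7 p i = c i p)
    (hlt : ∀ i < 2, ∀ p, c i p < L) : secondTerm.Holds L w ρ σ ↔
      ¬ (∀ p, c 0 p ≠ 0) ∨ (∀ p, c 1 p ≠ 0) ∧ numPriorities (c 1) < numPriorities (c 0) := by
  rw [secondTerm, holds_or, holds_not, holds_and, holds_lt, holds_totalTerm hin hσ (by omega),
    holds_totalTerm hin hσ (by omega), eval_countTerm hin hσ (by omega) (hlt 1 (by omega)),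
    eval_countTerm hin hσ (by omega) (hlt 0 (by omega))]

end

theorem greedy_le {A Q R Q' : Type*} {M : DPA A Q} {D : DPA A R} {T' : TransSystem A Q'}
    (start J : ℕ) (p : Q') : greedy M D T' start J p ≤ start := by
  by_cases h : greedy M D T' start J p = 0
  · omega
  · obtain ⟨j, -, -, -, hj, -⟩ := exists_greedy_round h
    omega

end DontCare

theorem Polynomial.eval_nat_mono (p : Polynomial ℕ) {x y : ℕ} (h : x ≤ y) :
    p.eval x ≤ p.eval y := by
  simp only [Polynomial.eval_eq_sum_range]
  exact Finset.sum_le_sum fun i _ => Nat.mul_le_mul_left _ (Nat.pow_le_pow_left h i)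

/-! ### Correctness of the whole program -/

namespace DontCare

open RAM RAM.Term

/-- The program for Quotient Don't Care Priority Optimization. -/
def solver : Prog := outputProg (contextTerm entryTerm) (contextTerm lengthTerm)

namespace Instance

variable (I : Instance)

/-- The assignment that the program computes in column `i`. -/
noncomputable def candidate (i : ℕ) : Fin I.n' → ℕ :=
  I.greedyPrio (I.encode.length - 2 + i) (I.encode.length * I.encode.length)

/-- This is why the runs start at `L - 2` and `L - 1` for an input of length `L`: all values lie
below `L`, where `countTerm` sees them. -/
theorem candidate_lt {i : ℕ} (hi : i < 2) (p : Fin I.n') : I.candidate i p < I.encode.length := by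
  have h : I.candidate i p ≤ I.encode.length - 2 + i := greedy_le _ _ p
  have := I.encodes.n'_lt
  omega

/-- One of the two candidates is total. -/
def Solvable : Prop := (∀ p, I.candidate 0 p ≠ 0) ∨ ∀ p, I.candidate 1 p ≠ 0

/-- The second candidate is to be taken. -/
def TakeSecond : Prop :=
  ¬ (∀ p, I.candidate 0 p ≠ 0) ∨
    (∀ p, I.candidate 1 p ≠ 0) ∧ numPriorities (I.candidate 1) < numPriorities (I.candidate 0)

open Classical in
/-- The better one of the candidates. -/
noncomputable def best : Fin I.n' → ℕ := if I.TakeSecond then I.candidate 1 else I.candidate 0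

open Classical in
/-- The answer that the program gives. -/
noncomputable def answer : Option (Fin I.n' → ℕ) := if I.Solvable then some I.best else none

theorem isCorrectAnswer_answer : I.IsCorrectAnswer I.answer := by
  have hn' := I.encodes.n'_lt
  -- With `I.n' + 2 < L`, both the first number `L - 2` and the number `L * L` of rounds are at
  -- least `I.n'`, as the comparison requires.
  have hle : ∀ c, I.IsSolution c → ∃ i < 2, (∀ p, I.candidate i p ≠ 0) ∧
      numPriorities (I.candidate i) ≤ numPriorities c := fun c hc =>
    I.exists_greedyPrio_le hc (by omega)
      ((by omega : I.n' ≤ I.encode.length).trans (Nat.le_mul_of_pos_left _ (by omega)))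
  unfold answer
  split_ifs with h
  · have hbest : I.IsSolution I.best ∧ ∀ i < 2, (∀ p, I.candidate i p ≠ 0) →
        numPriorities I.best ≤ numPriorities (I.candidate i) := by
      unfold best
      split_ifs with h2
      · have ht : ∀ p, I.candidate 1 p ≠ 0 := h2.elim h.resolve_left And.left
        refine ⟨I.isSolution_greedyPrio ht, fun i hi hi0 => ?_⟩
        interval_cases i
        · exact (h2.resolve_left (not_not.mpr hi0)).2.le
        · exact le_rfl
      · have h2' := not_or.mp h2
        have ht : ∀ p, I.candidate 0 p ≠ 0 := not_not.mp h2'.1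
        refine ⟨I.isSolution_greedyPrio ht, fun i hi hi0 => ?_⟩
        interval_cases i
        · exact le_rfl
        · exact not_lt.mp fun h3 => h2'.2 ⟨hi0, h3⟩
    refine ⟨hbest.1, fun c hc => ?_⟩
    obtain ⟨i, hi, h0, h1⟩ := hle c hc
    exact (hbest.2 i hi h0).trans h1
  · rintro ⟨c, hc⟩
    obtain ⟨i, hi, h0, -⟩ := hle c hc
    interval_cases i
    · exact h (Or.inl h0)
    · exact h (Or.inr h0)

open Classical in
theorem eval_lengthTerm : (contextTerm lengthTerm).eval I.encode.length (I.encode.getD · 0)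
    (fun _ => I.encode.length) (fun _ _ _ => 0) = if I.Solvable then I.n' + 1 else 1 := by
  have hin := I.encodes
  obtain ⟨σ, hσ, e⟩ := eval_contextTerm (ρ := fun _ => I.encode.length) (σ := fun _ _ _ => 0) hin rfl
    lengthTerm
  rw [e, lengthTerm, eval_cond]
  refine if_congr ?_ (by simp only [Term.eval, hin.n']) rfl
  rw [holds_or, holds_totalTerm hin hσ (by omega), holds_totalTerm hin hσ (by omega)]
  rfl

open Classical in
theorem eval_entryTerm_zero : (contextTerm entryTerm).eval I.encode.length (I.encode.getD · 0)
    (Function.update (fun _ => I.encode.length) 1 0) (fun _ _ _ => 0) =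
      if I.Solvable then 1 else 0 := by
  have hin := I.encodes
  obtain ⟨σ, hσ, e⟩ := eval_contextTerm (ρ := Function.update (fun _ => I.encode.length) 1 0)
    (σ := fun _ _ _ => 0) hin (by simp) entryTerm
  rw [e, entryTerm, eval_cond, if_neg (by simp [Holds, Term.eval]), eval_cond]
  refine if_congr ?_ rfl rfl
  rw [holds_or, holds_totalTerm hin hσ (by omega), holds_totalTerm hin hσ (by omega)]
  rfl

theorem eval_entryTerm_succ (p : Fin I.n') :
    (contextTerm entryTerm).eval I.encode.length (I.encode.getD · 0)
      (Function.update (fun _ => I.encode.length) 1 (p + 1)) (fun _ _ _ => 0) = I.best p := by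
  classical
  have hin := I.encodes
  have hn' := hin.n'_lt
  obtain ⟨σ, hσ, e⟩ := eval_contextTerm (ρ := Function.update (fun _ => I.encode.length) 1 (p + 1))
    (σ := fun _ _ _ => 0) hin (by simp) entryTerm
  have hget : ∀ i < 2, (Term.get 7 (.minus (.var 1) (.const 1)) (.const i)).eval I.encode.length
      (I.encode.getD · 0) (Function.update (fun _ => I.encode.length) 1 (p + 1)) σ =
      I.candidate i p := fun i hi => by
    rw [eval_get 7 (x := p) (y := i) (by simp [Term.eval]) rfl (by omega) (by omega)]
    exact hσ p i hi
  rw [e, entryTerm, eval_cond, if_pos (by simp [Holds, Term.eval]), eval_cond, hget 1 (by omega),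
    hget 0 (by omega), best]
  have hsec := holds_secondTerm (ρ := Function.update (fun _ => I.encode.length) 1 (p + 1)) hin hσ
    fun i hi p => I.candidate_lt hi p
  by_cases h : I.TakeSecond
  · rw [if_pos h, if_pos (hsec.mpr h)]
  · rw [if_neg h, if_neg fun h' => h (hsec.mp h')]

theorem haltsWith_solver :
    ∃ t ≤ (outputCost (contextTerm entryTerm) (contextTerm lengthTerm)).eval I.encode.length,
      HaltsWith solver I.encode (encodeAnswer I.answer) t := by
  have hn' := I.encodes.n'_lt
  obtain ⟨t, ht, h⟩ := haltsWith_outputProg (contextTerm entryTerm) (contextTerm lengthTerm)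
    I.encode (by rw [eval_lengthTerm]; split_ifs <;> omega)
  refine ⟨t, ht, ?_⟩
  unfold solver
  convert h using 1
  rw [eval_lengthTerm, answer]
  split_ifs with hs
  · rw [encodeAnswer, List.range_succ_eq_map, List.map_cons, List.map_map, eval_entryTerm_zero,
      if_pos hs]
    congr 1
    refine List.ext_getElem (by simp [encodeFun]) fun i h1 h2 => ?_
    have hi : i < I.n' := by simpa [encodeFun] using h1
    have := I.eval_entryTerm_succ ⟨i, hi⟩
    simpa [encodeFun] using this.symm
  · simp only [encodeAnswer, List.range_one, List.map_cons, List.map_nil, eval_entryTerm_zero,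
      if_neg hs]

end Instance

end DontCare

theorem theorem1 :
    ∃ (P : RAM.Prog) (p : Polynomial ℕ), ∀ I : DontCare.Instance,
      ∃ (r : Option (Fin I.n' → ℕ)) (t : ℕ),
        RAM.HaltsWith P I.encode (DontCare.encodeAnswer r) t ∧
        t ≤ p.eval (DontCare.bitSize I.encode) ∧
        I.IsCorrectAnswer r := by
  refine ⟨DontCare.solver, RAM.outputCost (DontCare.contextTerm DontCare.entryTerm)
    (DontCare.contextTerm DontCare.lengthTerm), fun I => ?_⟩
  obtain ⟨t, ht, h⟩ := I.haltsWith_solver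
  exact ⟨I.answer, t, h, ht.trans (Polynomial.eval_nat_mono _ I.length_encode_le),
    I.isCorrectAnswer_answer⟩
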